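/- Let $\mathcal E,\mathcal X_v,\mathcal X_w$ be finite dimensional complex Hilbert spaces and let $\{A_v \text{ on } \mathcal X_v,B_v,C_v,D_v\}$ and $\{A_w \text{ on } \mathcal X_w,B_w,C_w,D_w\}$ be stable unitary realizations with input and output space $\mathcal E$: all eigenvalues of $A_v$ and $A_w$ lie in the open unit disc, and the systems operators $\begin{bmatrix} A_v&B_v\\ C_v&D_v\end{bmatrix}$ on $\mathcal X_v\oplus\mathcal E$ and $\begin{bmatrix} A_w&B_w\\ C_w&D_w\end{bmatrix}$ on $\mathcal X_w\oplus\mathcal E$ are unitary. Put $$V(z)=D_v+zC_v(I-zA_v)^{-1}B_v,\qquad W(z)=D_w+zC_w(I-zA_w)^{-1}B_w,$$ and let $R(z)=V(z)W^*(z)$ for $|z|=1$, where $W^*(z)=\bigl(W(1/\overline z)\bigr)^*$. With $m=\dim\mathcal E$, integers $\kappa_1,\dots,\kappa_m$ are called Wiener–Hopf indices of $R$ if, after identifying $\mathcal E$ with $\mathbb C^m$ through some basis, $R(z)=W_-(z)\,\mathrm{diag}(z^{\kappa_j})_{j=1}^m\,W_+(z)$ for $|z|=1$, where $W_+$ and its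 inverse are analytic on the closed unit disc, and $W_-$ and its inverse are analytic outside the open unit disc, including infinity. Then $R$ has Wiener–Hopf indices. Moreover, the Stein equation $$\Omega_*=A_w\Omega_*A_v^*+B_wB_v^*$$ has a unique solution $\Omega_*:\mathcal X_v\to\mathcal X_w$ and, with $$C_{\circ *}=D_wB_v^*+C_w\Omega_*A_v^*,$$ the Stein equation $$Q_*=A_vQ_*A_v^*+C_{\circ *}^*C_{\circ *}$$ has a unique solution $Q_*$ on $\mathcal X_v$. For $k\ge 1$ put $$\nu_k=\dim\ker\bigl(I-A_v^{k-1}Q_*A_v^{*(k-1)}\bigr)-\dim\ker\bigl(I-A_v^{k}Q_*A_v^{*k}\bigr).$$ If $\omega_1\ge\omega_2\ge\dots\ge\omega_q$ are the positive Wiener–Hopf indices of $R$, counted with multiplicity, then $q=\nu_1$ and, for $j=1,\dots,q$, the set $\{k\ge 1:\nu_k\ge j\}$ is finite and $$\omega_j=\#\{k\ge 1:\nu_k\ge j\}.$$ -/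

import Mathlib

open scoped InnerProductSpace

noncomputable section

namespace WienerHopf

/-- A state space realization `{A on X, B, C, D}` with input and output space `E`. -/
structure Realization (X E : Type*)
    [NormedAddCommGroup X] [InnerProductSpace ℂ X]
    [NormedAddCommGroup E] [InnerProductSpace ℂ E] where
  A : X →L[ℂ] X
  B : E →L[ℂ] X
  C : X →L[ℂ] E
  D : E →L[ℂ] E

namespace Realization

variable {X E : Type*}
  [NormedAddCommGroup X] [InnerProductSpace ℂ X]
  [NormedAddCommGroup E] [InnerProductSpace ℂ E]

/-- The realization is stable: all eigenvalues of `A` lie in the open unit disc. -/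
def IsStable (r : Realization X E) : Prop :=
  ∀ μ : ℂ, Module.End.HasEigenvalue r.A.toLinearMap μ → ‖μ‖ < 1

/-- The systems operator `(x, u) ↦ (A x + B u, C x + D u)` on the Hilbert space direct sum of
`X` and `E`. -/
def systemsOperator (r : Realization X E) : WithLp 2 (X × E) →L[ℂ] WithLp 2 (X × E) :=
  (WithLp.prodContinuousLinearEquiv 2 ℂ X E).symm.toContinuousLinearMap ∘L
    ((r.A.coprod r.B).prod (r.C.coprod r.D)) ∘L
      (WithLp.prodContinuousLinearEquiv 2 ℂ X E).toContinuousLinearMap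

/-- The realization is unitary: its systems operator is unitary. -/
def IsUnitary [CompleteSpace X] [CompleteSpace E] (r : Realization X E) : Prop :=
  r.systemsOperator ∈ unitary (WithLp 2 (X × E) →L[ℂ] WithLp 2 (X × E))

/-- The function `D + z C (I - z A)⁻¹ B`. For a stable realization on a finite dimensional
space, `I - z A` is invertible for every `z` in the closed unit disc. -/
def transferFunction (r : Realization X E) (z : ℂ) : E →L[ℂ] E :=
  r.D + z • (r.C ∘L Ring.inverse (1 - z • r.A) ∘L r.B)

end Realization

variable {E : Type*} [NormedAddCommGroup E] [InnerProductSpace ℂ E]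

/-- `F^*(z) = F(1 / conj z)^*`. -/
def paraAdjoint [CompleteSpace E] (F : ℂ → E →L[ℂ] E) (z : ℂ) : E →L[ℂ] E :=
  ContinuousLinearMap.adjoint (F (1 / (starRingEnd ℂ) z))

/-- `F` and its pointwise inverse are analytic on (a neighbourhood of) the closed unit disc. -/
def IsPlusFactor (F : ℂ → E →L[ℂ] E) : Prop :=
  AnalyticOnNhd ℂ F (Metric.closedBall 0 1) ∧
    ∃ G : ℂ → E →L[ℂ] E, AnalyticOnNhd ℂ G (Metric.closedBall 0 1) ∧
      ∀ z ∈ Metric.closedBall (0 : ℂ) 1, F z * G z = 1 ∧ G z * F z = 1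

/-- `F` and its pointwise inverse are analytic outside the open unit disc, including infinity:
in the coordinate `w = 1 / z` they are analytic on the closed unit disc, and `w = 0` is the point
at infinity. -/
def IsMinusFactor (F : ℂ → E →L[ℂ] E) : Prop :=
  ∃ F' : ℂ → E →L[ℂ] E, IsPlusFactor F' ∧ ∀ z : ℂ, 1 ≤ ‖z‖ → F z = F' (1 / z)

/-- The operator on `E` with matrix `diag (z ^ κ j)` in the basis `b`. -/
def diagPow [FiniteDimensional ℂ E] {m : ℕ} (b : Module.Basis (Fin m) ℂ E)
    (κ : Fin m → ℤ) (z : ℂ) : E →L[ℂ] E :=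
  LinearMap.toContinuousLinearMap (Matrix.toLin b b (Matrix.diagonal fun j => z ^ κ j))

/-- The integers `κ j` are the Wiener-Hopf indices of `R` with respect to the unit circle: there
is a right Wiener-Hopf factorization `R(z) = W₋(z) diag (z ^ κ j) W₊(z)`, `|z| = 1`. The basis of
`E` identifies `E` with `ℂ ^ m`; changing it only changes the factors by constant invertible
operators. -/
def HasWienerHopfIndices [FiniteDimensional ℂ E] (R : ℂ → E →L[ℂ] E)
    (κ : Fin (Module.finrank ℂ E) → ℤ) : Prop :=
  ∃ (b : Module.Basis (Fin (Module.finrank ℂ E)) ℂ E) (Wm Wp : ℂ → E →L[ℂ] E),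
    IsMinusFactor Wm ∧ IsPlusFactor Wp ∧
      ∀ z : ℂ, ‖z‖ = 1 → R z = Wm z * diagPow b κ z * Wp z

/-- `ω 0 ≥ ω 1 ≥ … ≥ ω (q - 1)` lists the positive ones among the integers `κ j`, counted with
multiplicity. -/
def ListsPositive {m q : ℕ} (κ : Fin m → ℤ) (ω : Fin q → ℤ) : Prop :=
  Antitone ω ∧
    (Finset.univ.val.map ω : Multiset ℤ) = (Finset.univ.val.map κ).filter fun n => 0 < n

/-- `dim ker (I - A ^ k Q (A^*) ^ k)`. -/
def defectDim {X : Type*} [NormedAddCommGroup X] [InnerProductSpace ℂ X] [CompleteSpace X]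
    (A Q : X →L[ℂ] X) (k : ℕ) : ℕ :=
  Module.finrank ℂ
    (LinearMap.ker (1 - A ^ k * Q * ContinuousLinearMap.adjoint A ^ k : X →L[ℂ] X).toLinearMap)

/-- `ν k = dim ker (I - A ^ (k-1) Q (A^*) ^ (k-1)) - dim ker (I - A ^ k Q (A^*) ^ k)`, an integer,
for `k ≥ 1`. -/
def nu {X : Type*} [NormedAddCommGroup X] [InnerProductSpace ℂ X] [CompleteSpace X]
    (A Q : X →L[ℂ] X) (k : ℕ) : ℤ :=
  (defectDim A Q (k - 1) : ℤ) - (defectDim A Q k : ℤ)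

end WienerHopf

end

/-! On the circle $V$ and $W$ are unitary, so $R^*=WV^*$ there; this is `adjointSymbol`. The proof
identifies $\ker(I-A_v^kQ_*A_v^{*k})$ with the kernel of the Toeplitz operator whose symbol is
$z^kR^*$, and reads off its dimension from the Wiener–Hopf factorization.

State space side. Unitarity of both systems gives $Q_*=I-\Omega_*^*\Omega_*$ (`stein_solution_eq`).
Iterating the Stein equation gives
$I-A_v^kQ_*A_v^{*k}=\Omega_*^*\Omega_*+\sum_{i<k}A_v^iC_{\circ*}^*C_{\circ*}A_v^{*i}$, so the kernel
consists of the $x$ with $\Omega_*x=0$ and $C_{\circ*}A_v^{*i}x=0$ for $i<k$ (`mem_ker_defect`).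
With $f_x(z)=C_v(I-zA_v)^{-1}x$ one has
$R^*f_x=C_w(I-zA_w)^{-1}\Omega_*x+z^{-1}C_{\circ*}(I-z^{-1}A_v^*)^{-1}x$ on the circle
(`adjointSymbol_resolventAt`). Hence $x$ lies in the kernel exactly when $R^*f_x$ is $z^{-k-1}$
times a function analytic outside the disc (`mem_defect_iff`). Every analytic $f$ with this property
is some $f_x$ (`exists_state_of_adjointSymbol_eq`), and $x$ is unique by observability.

Function theory side. Taking adjoints in $R=W_-DW_+$ diagonalizes this condition: the $j$-th
coordinate of $W_-^*f$ is an arbitrary polynomial of degree less than $\kappa_j-k$. So the kernel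
has dimension $\sum_j\max(\kappa_j-k,0)$ (`finrank_defect`), $\nu_k$ counts the $j$ with
$\kappa_j\ge k$ (`nu_eq`), and the formula for $\omega_j$ is conjugation of partitions
(`succ_le_card_filter_iff`).

Existence of indices. On the circle $R=VW^{-1}$ is a polynomial matrix divided by a scalar
polynomial without zeros there. Polynomial matrices are factored by induction on the degree of the
determinant (`isFactorable_polynomial`), the crux being that one factor $z$ can be moved through a
minus factor (`IsPlusMatrix.isFactorable_shift`). -/

noncomputable section

namespace WienerHopf

open Metric

open ContinuousLinearMap (adjoint)

/-! ### Fourier coefficients of functions on the unit circle. -/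

section LaurentCoeff

variable {F G : Type*} [NormedAddCommGroup F] [NormedSpace ℂ F]
  [NormedAddCommGroup G] [NormedSpace ℂ G]

/-- The `n`-th Fourier coefficient of a function on the unit circle. -/
def laurentCoeff (n : ℤ) (f : ℂ → F) : F :=
  Real.circleAverage (fun z => z ^ (-n) • f z) 0 1

theorem ne_zero_of_mem_sphere {z : ℂ} (hz : z ∈ sphere (0 : ℂ) 1) : z ≠ 0 := by
  rintro rfl
  simp at hz

theorem continuousOn_zpow_sphere (n : ℤ) :
    ContinuousOn (fun z : ℂ => z ^ n) (sphere 0 1) :=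
  fun z hz => (continuousAt_zpow₀ z n (Or.inl (ne_zero_of_mem_sphere hz))).continuousWithinAt

theorem circleIntegrable_zpow_smul {f : ℂ → F} (hf : ContinuousOn f (sphere 0 1)) (n : ℤ) :
    CircleIntegrable (fun z => z ^ n • f z) 0 1 :=
  ContinuousOn.circleIntegrable zero_le_one ((continuousOn_zpow_sphere n).smul hf)

theorem laurentCoeff_congr {f g : ℂ → F} (h : Set.EqOn f g (sphere 0 1)) (n : ℤ) :
    laurentCoeff n f = laurentCoeff n g := by
  refine Real.circleAverage_congr_sphere fun z hz => ?_
  rw [abs_one] at hz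
  simp only [h hz]

theorem laurentCoeff_add {f g : ℂ → F} (hf : ContinuousOn f (sphere 0 1))
    (hg : ContinuousOn g (sphere 0 1)) (n : ℤ) :
    laurentCoeff n (fun z => f z + g z) = laurentCoeff n f + laurentCoeff n g := by
  simp only [laurentCoeff, smul_add]
  exact Real.circleAverage_fun_add (circleIntegrable_zpow_smul hf _)
    (circleIntegrable_zpow_smul hg _)

theorem laurentCoeff_sub {f g : ℂ → F} (hf : ContinuousOn f (sphere 0 1))
    (hg : ContinuousOn g (sphere 0 1)) (n : ℤ) :
    laurentCoeff n (fun z => f z - g z) = laurentCoeff n f - laurentCoeff n g := by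
  simp only [laurentCoeff, smul_sub]
  exact Real.circleAverage_fun_sub (circleIntegrable_zpow_smul hf _)
    (circleIntegrable_zpow_smul hg _)

theorem laurentCoeff_smul (c : ℂ) (f : ℂ → F) (n : ℤ) :
    laurentCoeff n (fun z => c • f z) = c • laurentCoeff n f := by
  simp only [laurentCoeff, smul_comm _ c]
  exact Real.circleAverage_fun_smul

theorem laurentCoeff_sum {ι : Type*} (s : Finset ι) {f : ι → ℂ → F}
    (hf : ∀ i ∈ s, ContinuousOn (f i) (sphere 0 1)) (n : ℤ) :
    laurentCoeff n (fun z => ∑ i ∈ s, f i z) = ∑ i ∈ s, laurentCoeff n (f i) := by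
  simp only [laurentCoeff, Finset.smul_sum]
  exact Real.circleAverage_fun_sum fun i hi => circleIntegrable_zpow_smul (hf i hi) _

theorem laurentCoeff_map [CompleteSpace F] [CompleteSpace G] (L : F →L[ℂ] G) {f : ℂ → F}
    (hf : ContinuousOn f (sphere 0 1)) (n : ℤ) :
    laurentCoeff n (fun z => L (f z)) = L (laurentCoeff n f) := by
  have := (L.restrictScalars ℝ).circleAverage_comp_comm (circleIntegrable_zpow_smul hf (-n))
  simpa [laurentCoeff, Function.comp_def] using this

theorem laurentCoeff_zpow_smul (p n : ℤ) (f : ℂ → F) :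
    laurentCoeff n (fun z => z ^ p • f z) = laurentCoeff (n - p) f := by
  refine Real.circleAverage_congr_sphere fun z hz => ?_
  rw [abs_one] at hz
  simp only [smul_smul]
  rw [← zpow_add₀ (ne_zero_of_mem_sphere hz)]
  congr 2
  ring

theorem laurentCoeff_comp_inv (n : ℤ) (g : ℂ → F) :
    laurentCoeff n (fun z => g (1 / z)) = laurentCoeff (-n) g := by
  simp only [laurentCoeff, one_div]
  rw [← Real.circleAverage_zero_one_congr_inv (f := fun z => z ^ (-(-n)) • g z)]
  simp

theorem AnalyticOnNhd.continuousOn_sphere {f : ℂ → F}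
    (hf : AnalyticOnNhd ℂ f (closedBall 0 1)) : ContinuousOn f (sphere 0 1) :=
  hf.continuousOn.mono sphere_subset_closedBall

theorem one_div_mem_sphere {z : ℂ} (hz : z ∈ sphere (0 : ℂ) 1) : 1 / z ∈ sphere (0 : ℂ) 1 := by
  simp_all

theorem AnalyticOnNhd.continuousOn_sphere_inv {f : ℂ → F}
    (hf : AnalyticOnNhd ℂ f (closedBall 0 1)) :
    ContinuousOn (fun z => f (1 / z)) (sphere 0 1) := by
  refine (AnalyticOnNhd.continuousOn_sphere hf).comp ?_ fun z hz => one_div_mem_sphere hz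
  exact continuousOn_const.div continuousOn_id fun z hz => ne_zero_of_mem_sphere hz

theorem circleAverage_of_analyticOnNhd [CompleteSpace F] {f : ℂ → F}
    (hf : AnalyticOnNhd ℂ f (closedBall 0 1)) : Real.circleAverage f 0 1 = f 0 := by
  apply DiffContOnCl.circleAverage
  rw [abs_one]
  apply DifferentiableOn.diffContOnCl
  rw [closure_ball _ one_ne_zero]
  exact hf.differentiableOn

theorem laurentCoeff_zero_of_analyticOnNhd [CompleteSpace F] {f : ℂ → F}
    (hf : AnalyticOnNhd ℂ f (closedBall 0 1)) : laurentCoeff 0 f = f 0 := by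
  simp [laurentCoeff, circleAverage_of_analyticOnNhd hf]

/-- The coefficient of index $-(k+1)$ is the circle average of $z^{k+1}f$, which is analytic and
vanishes at $0$. -/
theorem laurentCoeff_neg_of_analyticOnNhd [CompleteSpace F] {f : ℂ → F}
    (hf : AnalyticOnNhd ℂ f (closedBall 0 1)) {n : ℤ} (hn : n < 0) : laurentCoeff n f = 0 := by
  obtain ⟨k, rfl⟩ : ∃ k : ℕ, n = -((k : ℤ) + 1) := ⟨(-n - 1).toNat, by omega⟩
  have h : AnalyticOnNhd ℂ (fun z => z ^ (k + 1) • f z) (closedBall 0 1) :=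
    fun z hz => (analyticAt_id.pow _).smul (hf z hz)
  have h2 := circleAverage_of_analyticOnNhd h
  simp only [ne_eq, Nat.add_eq_zero_iff, one_ne_zero, and_false, not_false_eq_true, zero_pow,
    zero_smul] at h2
  rw [← h2, laurentCoeff]
  congr 1

theorem laurentCoeff_pos_of_analyticOnNhd_inv [CompleteSpace F] {g : ℂ → F}
    (hg : AnalyticOnNhd ℂ g (closedBall 0 1)) {n : ℤ} (hn : 0 < n) :
    laurentCoeff n (fun z => g (1 / z)) = 0 := by
  rw [laurentCoeff_comp_inv]
  exact laurentCoeff_neg_of_analyticOnNhd hg (by omega)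

theorem laurentCoeff_const [CompleteSpace F] (a : F) (n : ℤ) :
    laurentCoeff n (fun _ => a) = if n = 0 then a else 0 := by
  have h : AnalyticOnNhd ℂ (fun _ : ℂ => a) (closedBall 0 1) := analyticOnNhd_const
  rcases lt_trichotomy n 0 with hn | rfl | hn
  · rw [laurentCoeff_neg_of_analyticOnNhd h hn, if_neg hn.ne]
  · rw [laurentCoeff_zero_of_analyticOnNhd h, if_pos rfl]
  · rw [if_neg hn.ne']
    exact laurentCoeff_pos_of_analyticOnNhd_inv h hn

theorem laurentCoeff_zpow_smul_const [CompleteSpace F] (a : F) (p n : ℤ) :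
    laurentCoeff n (fun z => z ^ p • a) = if n = p then a else 0 := by
  rw [laurentCoeff_zpow_smul, laurentCoeff_const]
  simp only [sub_eq_zero]

/-- Zero coefficients are trivially summable, so the Fourier series converges to the continuous
function itself; no smoothness is needed. -/
theorem eq_zero_of_laurentCoeff_complex {f : ℂ → ℂ} (hf : ContinuousOn f (sphere 0 1))
    (h : ∀ n, laurentCoeff n f = 0) {z : ℂ} (hz : z ∈ sphere (0 : ℂ) 1) : f z = 0 := by
  have : Fact (0 < 2 * Real.pi) := ⟨Real.two_pi_pos⟩
  have hmem : ∀ x : AddCircle (2 * Real.pi),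
      (AddCircle.toCircle x : ℂ) ∈ sphere (0 : ℂ) 1 := fun x => by
    rw [mem_sphere_zero_iff_norm, Circle.norm_coe]
  have hcoe : ∀ θ : ℝ, (AddCircle.toCircle (θ : AddCircle (2 * Real.pi)) : ℂ)
      = Complex.exp (θ * Complex.I) := fun θ => by
    rw [AddCircle.toCircle_apply_mk, Circle.coe_exp, div_self Real.two_pi_pos.ne', one_mul]
  let g : C(AddCircle (2 * Real.pi), ℂ) :=
    ⟨fun x => f (AddCircle.toCircle x), hf.comp_continuous
      (continuous_subtype_val.comp AddCircle.continuous_toCircle) hmem⟩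
  have hg : ∀ n, fourierCoeff g n = 0 := fun n => by
    rw [← h n, fourierCoeff_eq_intervalIntegral _ _ 0, laurentCoeff, Real.circleAverage]
    simp only [zero_add, one_div, g, ContinuousMap.coe_mk]
    congr 1
    apply intervalIntegral.integral_congr
    intro θ _
    have h1 : (AddCircle.toCircle (θ : AddCircle (2 * Real.pi)) : ℂ) = circleMap 0 1 θ := by
      rw [hcoe, circleMap]
      simp
    have h2 : fourier (-n) (θ : AddCircle (2 * Real.pi)) = (circleMap 0 1 θ) ^ (-n) := by
      rw [fourier_apply, AddCircle.toCircle_zsmul, Circle.coe_zpow, h1]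
    simp only [h1, h2]
  have hg0 : g = 0 := by
    have hs : Summable (fourierCoeff g) := by
      rw [show fourierCoeff g = 0 from funext hg]
      exact summable_zero
    have := hasSum_fourier_series_of_summable hs
    simp only [hg, zero_smul] at this
    exact this.unique hasSum_zero
  have hz1 : ‖z‖ = 1 := by simpa using hz
  have hze : (AddCircle.toCircle ((z.arg : ℝ) : AddCircle (2 * Real.pi)) : ℂ) = z := by
    rw [hcoe]
    conv_rhs => rw [← Complex.norm_mul_exp_arg_mul_I z, hz1]
    simp
  have := DFunLike.congr_fun hg0 ((z.arg : ℝ) : AddCircle (2 * Real.pi))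
  simpa only [g, hze, ContinuousMap.coe_mk, ContinuousMap.zero_apply] using this

theorem eq_zero_of_laurentCoeff [CompleteSpace F] {f : ℂ → F} (hf : ContinuousOn f (sphere 0 1))
    (h : ∀ n, laurentCoeff n f = 0) {z : ℂ} (hz : z ∈ sphere (0 : ℂ) 1) : f z = 0 := by
  by_contra hne
  obtain ⟨L, hL⟩ := SeparatingDual.exists_ne_zero (R := ℂ) hne
  refine hL (eq_zero_of_laurentCoeff_complex (f := fun z => L (f z))
    (L.continuous.comp_continuousOn hf) (fun n => ?_) hz)
  rw [laurentCoeff_map L hf, h, map_zero]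

theorem eqOn_of_laurentCoeff [CompleteSpace F] {f g : ℂ → F} (hf : ContinuousOn f (sphere 0 1))
    (hg : ContinuousOn g (sphere 0 1)) (h : ∀ n, laurentCoeff n f = laurentCoeff n g) :
    Set.EqOn f g (sphere 0 1) := fun z hz => by
  rw [← sub_eq_zero]
  refine eq_zero_of_laurentCoeff (f := fun z => f z - g z) (hf.sub hg) (fun n => ?_) hz
  rw [laurentCoeff_sub hf hg, h, sub_self]

end LaurentCoeff

/-! ### Stable operators, their resolvents, and Stein equations. -/

section Stable

variable {X Y : Type*}
  [NormedAddCommGroup X] [InnerProductSpace ℂ X]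
  [NormedAddCommGroup Y] [InnerProductSpace ℂ Y]

/-- All eigenvalues of the operator lie in the open unit disc. -/
def IsStableOperator (A : X →L[ℂ] X) : Prop :=
  ∀ μ : ℂ, Module.End.HasEigenvalue A.toLinearMap μ → ‖μ‖ < 1

theorem IsStableOperator.norm_lt_one {A : X →L[ℂ] X} (hA : IsStableOperator A) {μ : ℂ} {x : X}
    (hx : x ≠ 0) (h : A x = μ • x) : ‖μ‖ < 1 :=
  hA μ (Module.End.hasEigenvalue_of_hasEigenvector (x := x) ⟨Module.End.mem_eigenspace_iff.2 h, hx⟩)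

variable [FiniteDimensional ℂ X] [FiniteDimensional ℂ Y]

theorem isUnit_of_ker_eq_zero {T : X →L[ℂ] X} (h : ∀ x, T x = 0 → x = 0) : IsUnit T := by
  have hi : LinearMap.ker T.toLinearMap = ⊥ := by
    rw [LinearMap.ker_eq_bot']
    exact h
  let e : X ≃L[ℂ] X :=
    (LinearEquiv.ofInjectiveEndo T.toLinearMap (LinearMap.ker_eq_bot.1 hi)).toContinuousLinearEquiv
  exact ⟨ContinuousLinearEquiv.toUnit e, by ext x; rfl⟩

theorem IsStableOperator.isUnit {A : X →L[ℂ] X} (hA : IsStableOperator A) {z : ℂ}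
    (hz : ‖z‖ ≤ 1) : IsUnit (1 - z • A) := by
  apply isUnit_of_ker_eq_zero
  intro x hx
  by_contra hne
  have h1 : x = z • A x := by simpa [sub_eq_zero] using hx
  have hz0 : z ≠ 0 := by
    rintro rfl
    exact hne (by simpa using h1)
  have h2 : A x = z⁻¹ • x := by
    conv_rhs => rw [h1]
    rw [smul_smul, inv_mul_cancel₀ hz0, one_smul]
  have h3 := hA.norm_lt_one hne h2
  rw [norm_inv] at h3
  have h4 : 1 ≤ ‖z‖⁻¹ := (one_le_inv₀ (norm_pos_iff.2 hz0)).2 hz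
  linarith

/-- The resolvent `(I - z A)⁻¹`. -/
def resolventAt (A : X →L[ℂ] X) (z : ℂ) : X →L[ℂ] X := Ring.inverse (1 - z • A)

theorem IsStableOperator.resolventAt_sub {A : X →L[ℂ] X} (hA : IsStableOperator A) {z : ℂ}
    (hz : ‖z‖ ≤ 1) (x : X) : resolventAt A z (x - z • A x) = x := by
  simpa [resolventAt] using DFunLike.congr_fun (Ring.inverse_mul_cancel _ (hA.isUnit hz)) x

theorem IsStableOperator.sub_resolventAt {A : X →L[ℂ] X} (hA : IsStableOperator A) {z : ℂ}
    (hz : ‖z‖ ≤ 1) (x : X) : resolventAt A z x - z • A (resolventAt A z x) = x := by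
  simpa [resolventAt] using DFunLike.congr_fun (Ring.mul_inverse_cancel _ (hA.isUnit hz)) x

theorem IsStableOperator.analyticOnNhd_resolventAt {A : X →L[ℂ] X} (hA : IsStableOperator A) :
    AnalyticOnNhd ℂ (resolventAt A) (closedBall 0 1) := by
  have := FiniteDimensional.complete ℂ X
  intro z hz
  have hz1 : ‖z‖ ≤ 1 := by simpa using hz
  obtain ⟨u, hu⟩ := hA.isUnit hz1
  have h1 : AnalyticAt ℂ (Ring.inverse : (X →L[ℂ] X) → (X →L[ℂ] X)) (1 - z • A) := by
    rw [← hu]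
    exact analyticAt_inverse u
  exact h1.fun_comp (f := fun z : ℂ => 1 - z • A)
    (analyticAt_const.fun_sub (analyticAt_id.fun_smul analyticAt_const))

theorem IsStableOperator.analyticOnNhd_resolventAt_apply {A : X →L[ℂ] X} (hA : IsStableOperator A)
    {F : Type*} [NormedAddCommGroup F] [NormedSpace ℂ F] (L : X →L[ℂ] F) (x : X) :
    AnalyticOnNhd ℂ (fun z => L (resolventAt A z x)) (closedBall 0 1) := fun z hz =>
  ((L.comp (ContinuousLinearMap.apply ℂ X x)).analyticAt _).fun_comp
    (hA.analyticOnNhd_resolventAt z hz)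

/-- Induction on $n$ through $(I-zA)^{-1}x=x+zA(I-zA)^{-1}x$; no power series expansion is needed.
-/
theorem IsStableOperator.laurentCoeff_resolventAt {A : X →L[ℂ] X} (hA : IsStableOperator A)
    {F : Type*} [NormedAddCommGroup F] [NormedSpace ℂ F] [CompleteSpace F]
    (L : X →L[ℂ] F) (x : X) (n : ℕ) :
    laurentCoeff n (fun z => L (resolventAt A z x)) = L ((A ^ n) x) := by
  have := FiniteDimensional.complete ℂ X
  have han := hA.analyticOnNhd_resolventAt_apply (ContinuousLinearMap.id ℂ X) x
  simp only [ContinuousLinearMap.id_apply] at han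
  have hc := AnalyticOnNhd.continuousOn_sphere han
  rw [laurentCoeff_map L hc]
  congr 1
  induction n with
  | zero =>
    rw [Nat.cast_zero, laurentCoeff_zero_of_analyticOnNhd han]
    simp [resolventAt]
  | succ n ih =>
    have hAc : ContinuousOn (fun z => A (resolventAt A z x)) (sphere 0 1) :=
      A.continuous.comp_continuousOn hc
    have hzAc : ContinuousOn (fun z : ℂ => z ^ (1 : ℤ) • A (resolventAt A z x)) (sphere 0 1) :=
      (continuousOn_zpow_sphere 1).smul hAc
    have h1 : Set.EqOn (fun z => resolventAt A z x)
        (fun z => x + z ^ (1 : ℤ) • A (resolventAt A z x)) (sphere 0 1) := fun z hz => by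
      have hz1 : ‖z‖ = 1 := by simpa using hz
      simp only [zpow_one]
      rw [← sub_eq_iff_eq_add]
      exact hA.sub_resolventAt hz1.le x
    rw [laurentCoeff_congr h1, laurentCoeff_add continuousOn_const hzAc,
      laurentCoeff_zpow_smul, laurentCoeff_const,
      laurentCoeff_map A hc, if_neg (by norm_cast)]
    have h2 : ((n + 1 : ℕ) : ℤ) - 1 = n := by push_cast; ring
    rw [h2, ih, zero_add, pow_succ']
    rfl

theorem IsStableOperator.adjoint [CompleteSpace X] {A : X →L[ℂ] X} (hA : IsStableOperator A) :
    IsStableOperator (ContinuousLinearMap.adjoint A) := by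
  intro μ hμ
  by_contra hcon
  obtain ⟨x, hx⟩ := hμ.exists_hasEigenvector
  have hμ0 : μ ≠ 0 := by
    rintro rfl
    simp at hcon
  have hu : IsUnit (1 - (starRingEnd ℂ μ)⁻¹ • A) := by
    apply hA.isUnit
    rw [norm_inv, RCLike.norm_conj]
    exact inv_le_one_of_one_le₀ (not_lt.1 hcon)
  have hu2 := hu.star
  rw [star_sub, star_one, star_smul] at hu2
  obtain ⟨u, hu3⟩ := hu2
  apply hx.2
  have h0 : (u : X →L[ℂ] X) x = 0 := by
    rw [hu3]
    have h1 : ContinuousLinearMap.adjoint A x = μ • x := hx.apply_eq_smul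
    simp only [ContinuousLinearMap.star_eq_adjoint, sub_apply,
      smul_apply, one_apply_eq_self, h1]
    rw [smul_smul]
    simp [hμ0]
  have := congrArg (fun y => ((u⁻¹ : (X →L[ℂ] X)ˣ) : X →L[ℂ] X) y) h0
  simpa [← mul_apply_eq_comp] using this

/-- The homogeneous solutions form a space invariant under $Z\mapsto AZ$. If it is nonzero, this map
has an eigenvector $W$, so $AW=\mu W$ with $|\mu|<1$ and $W=\mu WT^*$. Taking adjoints,
$TW^*=\bar\mu^{-1}W^*$ gives $T$ an eigenvalue outside the disc. -/
theorem IsStableOperator.eq_zero_of_stein [CompleteSpace X] {A : Y →L[ℂ] Y} {T : X →L[ℂ] X}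
    (hA : IsStableOperator A) (hT : IsStableOperator T) {Z : X →L[ℂ] Y}
    (hZ : Z = A ∘L Z ∘L ContinuousLinearMap.adjoint T) : Z = 0 := by
  have := FiniteDimensional.complete ℂ Y
  let K : Submodule ℂ (X →L[ℂ] Y) :=
    { carrier := {Z | Z = A ∘L Z ∘L ContinuousLinearMap.adjoint T}
      add_mem' := by
        intro Z W hZ hW
        simp only [Set.mem_ofPred_eq] at hZ hW ⊢
        rw [ContinuousLinearMap.add_comp, ContinuousLinearMap.comp_add, ← hZ, ← hW]
      zero_mem' := by simp
      smul_mem' := by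
        intro c Z hZ
        simp only [Set.mem_ofPred_eq] at hZ ⊢
        rw [ContinuousLinearMap.smul_comp, ContinuousLinearMap.comp_smul, ← hZ] }
  let f : K →ₗ[ℂ] K :=
    { toFun := fun Z => ⟨A ∘L Z.1, by
        have h := Z.2
        change Z.1 = _ at h
        change A ∘L Z.1 = _
        conv_lhs => rw [h]
        rfl⟩
      map_add' := fun Z W => by ext x; simp
      map_smul' := fun c Z => by ext x; simp }
  by_contra hne
  have : Nontrivial K := ⟨⟨⟨Z, hZ⟩, 0, fun h => hne (congrArg Subtype.val h)⟩⟩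
  obtain ⟨μ, hμ⟩ := Module.End.exists_eigenvalue f
  obtain ⟨W, hW⟩ := hμ.exists_hasEigenvector
  have hW0 : W.1 ≠ 0 := fun h => hW.2 (Subtype.ext h)
  have h1 : ∀ x, A (W.1 x) = μ • W.1 x := fun x =>
    DFunLike.congr_fun (congrArg Subtype.val hW.apply_eq_smul) x
  obtain ⟨x, hx⟩ := DFunLike.ne_iff.1 hW0
  have hμ1 := hA.norm_lt_one hx (h1 x)
  have h2 : ∀ x, W.1 x = μ • W.1 (ContinuousLinearMap.adjoint T x) := fun x => by
    rw [← h1]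
    exact DFunLike.congr_fun W.2 x
  have hμ0 : μ ≠ 0 := by
    rintro rfl
    exact hx (by rw [h2]; simp)
  let Wa := ContinuousLinearMap.adjoint W.1
  have h3 : ∀ y, Wa y = starRingEnd ℂ μ • T (Wa y) := fun y => by
    apply ext_inner_left ℂ
    intro x
    rw [inner_smul_right, ← ContinuousLinearMap.adjoint_inner_left T,
      ContinuousLinearMap.adjoint_inner_right, ContinuousLinearMap.adjoint_inner_right, h2 x,
      inner_smul_left]
  obtain ⟨y, hy⟩ : ∃ y, Wa y ≠ 0 := by
    by_contra! h
    apply hx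
    apply ext_inner_right ℂ
    intro y
    rw [← ContinuousLinearMap.adjoint_inner_right]
    change ⟪x, Wa y⟫_ℂ = _
    rw [h y]
    simp
  have h4 : T (Wa y) = (starRingEnd ℂ μ)⁻¹ • Wa y := by
    conv_rhs => rw [h3]
    rw [smul_smul, inv_mul_cancel₀ (by simpa using hμ0), one_smul]
  have h5 := hT.norm_lt_one hy h4
  rw [norm_inv, RCLike.norm_conj] at h5
  have := (one_lt_inv₀ (norm_pos_iff.2 hμ0)).2 hμ1
  linarith

theorem IsStableOperator.existsUnique_stein [CompleteSpace X] {A : Y →L[ℂ] Y} {T : X →L[ℂ] X}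
    (hA : IsStableOperator A) (hT : IsStableOperator T) (Γ : X →L[ℂ] Y) :
    ∃! Z : X →L[ℂ] Y, Z = A ∘L Z ∘L ContinuousLinearMap.adjoint T + Γ := by
  let f : (X →L[ℂ] Y) →ₗ[ℂ] (X →L[ℂ] Y) :=
    { toFun := fun Z => Z - A ∘L Z ∘L ContinuousLinearMap.adjoint T
      map_add' := fun Z W => by
        rw [ContinuousLinearMap.add_comp, ContinuousLinearMap.comp_add]; abel
      map_smul' := fun c Z => by
        rw [ContinuousLinearMap.smul_comp, ContinuousLinearMap.comp_smul, smul_sub]; rfl }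
  have hinj : Function.Injective f := by
    rw [← LinearMap.ker_eq_bot, LinearMap.ker_eq_bot']
    intro Z hZ
    exact hA.eq_zero_of_stein hT (sub_eq_zero.1 hZ)
  obtain ⟨Z, hZ⟩ := LinearMap.surjective_of_injective hinj Γ
  refine ⟨Z, sub_eq_iff_eq_add'.1 hZ, fun W hW => hinj ?_⟩
  rw [hZ]
  exact sub_eq_iff_eq_add'.2 hW

end Stable

/-! ### Unitary realizations: inner transfer functions and observability. -/

namespace Realization

section Dual

variable {X E : Type*}
  [NormedAddCommGroup X] [InnerProductSpace ℂ X]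
  [NormedAddCommGroup E] [InnerProductSpace ℂ E]

theorem systemsOperator_apply (r : Realization X E) (p : WithLp 2 (X × E)) :
    r.systemsOperator p = WithLp.toLp 2 (r.A p.fst + r.B p.snd, r.C p.fst + r.D p.snd) := rfl

theorem IsStable.isStableOperator {r : Realization X E} (hr : r.IsStable) :
    IsStableOperator r.A := hr

theorem transferFunction_apply (r : Realization X E) (z : ℂ) (u : E) :
    r.transferFunction z u = r.D u + z • r.C (resolventAt r.A z (r.B u)) := rfl

variable [CompleteSpace X] [CompleteSpace E]

/-- The realization `{A^*, C^*, B^*, D^*}`. -/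
def dual (r : Realization X E) : Realization X E :=
  ⟨adjoint r.A, adjoint r.C, adjoint r.B, adjoint r.D⟩

theorem star_systemsOperator (r : Realization X E) :
    star r.systemsOperator = r.dual.systemsOperator := by
  rw [ContinuousLinearMap.star_eq_adjoint, eq_comm, ContinuousLinearMap.eq_adjoint_iff]
  intro p q
  simp only [systemsOperator_apply, WithLp.prod_inner_apply, dual, inner_add_left, inner_add_right,
    ContinuousLinearMap.adjoint_inner_left]
  simp only [WithLp.ofLp_fst, WithLp.ofLp_snd]
  ring

theorem IsUnitary.dual {r : Realization X E} (hr : r.IsUnitary) : r.dual.IsUnitary := by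
  unfold IsUnitary
  rw [← star_systemsOperator]
  exact Unitary.star_mem hr

theorem dual_dual (r : Realization X E) : r.dual.dual = r := by
  simp [Realization.dual]

theorem IsUnitary.dual_apply {r : Realization X E} (hr : r.IsUnitary) (x : X) (u : E) :
    adjoint r.A (r.A x + r.B u) + adjoint r.C (r.C x + r.D u) = x ∧
      adjoint r.B (r.A x + r.B u) + adjoint r.D (r.C x + r.D u) = u := by
  have h := DFunLike.congr_fun (Unitary.star_mul_self_of_mem hr) (WithLp.toLp 2 (x, u))
  rw [star_systemsOperator, mul_apply_eq_comp, systemsOperator_apply, systemsOperator_apply] at h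
  exact Prod.ext_iff.1 (congrArg WithLp.ofLp h)

theorem IsUnitary.adjoint_A_A {r : Realization X E} (hr : r.IsUnitary) (x : X) :
    adjoint r.A (r.A x) + adjoint r.C (r.C x) = x := by
  simpa using (hr.dual_apply x 0).1

theorem IsUnitary.adjoint_B_A {r : Realization X E} (hr : r.IsUnitary) (x : X) :
    adjoint r.B (r.A x) + adjoint r.D (r.C x) = 0 := by
  simpa using (hr.dual_apply x 0).2

theorem IsUnitary.adjoint_A_B {r : Realization X E} (hr : r.IsUnitary) (u : E) :
    adjoint r.A (r.B u) + adjoint r.C (r.D u) = 0 := by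
  simpa using (hr.dual_apply 0 u).1

theorem IsUnitary.adjoint_B_B {r : Realization X E} (hr : r.IsUnitary) (u : E) :
    adjoint r.B (r.B u) + adjoint r.D (r.D u) = u := by
  simpa using (hr.dual_apply 0 u).2

theorem IsUnitary.A_adjoint_A {r : Realization X E} (hr : r.IsUnitary) (x : X) :
    r.A (adjoint r.A x) + r.B (adjoint r.B x) = x := by
  simpa [Realization.dual] using hr.dual.adjoint_A_A x

theorem IsUnitary.norm_sq {r : Realization X E} (hr : r.IsUnitary) (x : X) :
    ‖r.A x‖ ^ 2 + ‖r.C x‖ ^ 2 = ‖x‖ ^ 2 := by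
  have h := congrArg (fun y => RCLike.re ⟪y, x⟫_ℂ) (hr.adjoint_A_A x)
  simp only [inner_add_left, ContinuousLinearMap.adjoint_inner_left, map_add] at h
  simpa only [inner_self_eq_norm_sq] using h

theorem adjoint_transferFunction (r : Realization X E) (z : ℂ) :
    adjoint (r.transferFunction z) = r.dual.transferFunction (starRingEnd ℂ z) := by
  have h : star (resolventAt r.A z) = resolventAt (adjoint r.A) (starRingEnd ℂ z) := by
    rw [resolventAt, ← Ring.inverse_star, star_sub, star_one, star_smul]
    rfl
  change star (r.D + z • (r.C ∘L resolventAt r.A z ∘L r.B)) = _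
  rw [star_add, star_smul, ContinuousLinearMap.star_eq_adjoint, ContinuousLinearMap.star_eq_adjoint,
    ContinuousLinearMap.adjoint_comp, ContinuousLinearMap.adjoint_comp,
    ← ContinuousLinearMap.star_eq_adjoint (resolventAt r.A z), h]
  rfl

theorem paraAdjoint_transferFunction (r : Realization X E) (z : ℂ) :
    paraAdjoint r.transferFunction z = r.dual.transferFunction (1 / z) := by
  rw [paraAdjoint, adjoint_transferFunction]
  simp

variable [FiniteDimensional ℂ X]

theorem IsStable.dual {r : Realization X E} (hr : r.IsStable) : r.dual.IsStable :=
  hr.isStableOperator.adjoint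

theorem IsStable.analyticOnNhd_transferFunction {r : Realization X E} (hr : r.IsStable) :
    AnalyticOnNhd ℂ r.transferFunction (closedBall 0 1) := fun z hz => by
  have h1 := hr.isStableOperator.analyticOnNhd_resolventAt z hz
  let L : (X →L[ℂ] X) →L[ℂ] (E →L[ℂ] E) := (ContinuousLinearMap.compL ℂ E X E r.C) ∘L
    ((ContinuousLinearMap.compL ℂ E X X).flip r.B)
  have h2 : AnalyticAt ℂ (fun z => L (resolventAt r.A z)) z := (L.analyticAt _).fun_comp h1
  exact analyticAt_const.add (analyticAt_id.smul h2)

/-- With $y=(I-zA)^{-1}x$, unitarity turns $D^*Cy$ into $-B^*Ay$ and $C^*Cy$ into $y-A^*Ay$; the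
terms in $Ay$ then cancel against the resolvent of $A^*$. So $V^*$ sends $C(I-zA)^{-1}x$ to a
function analytic outside the disc and zero at infinity. -/
theorem dual_transferFunction_resolventAt {r : Realization X E} (hs : r.IsStable)
    (hr : r.IsUnitary) {z : ℂ} (hz : ‖z‖ = 1) (x : X) :
    r.dual.transferFunction (1 / z) (r.C (resolventAt r.A z x)) =
      (1 / z) • adjoint r.B (resolventAt (adjoint r.A) (1 / z) x) := by
  have hz0 : z ≠ 0 := by rintro rfl; simp at hz
  have hz' : ‖1 / z‖ ≤ 1 := by simp [hz]
  have h1 := hs.isStableOperator.sub_resolventAt hz.le x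
  set y := resolventAt r.A z x
  rw [transferFunction_apply]
  simp only [Realization.dual]
  have h2 : adjoint r.D (r.C y) = - adjoint r.B (r.A y) :=
    eq_neg_of_add_eq_zero_right (hr.adjoint_B_A y)
  have h3 : adjoint r.C (r.C y) = y - adjoint r.A (r.A y) :=
    eq_sub_of_add_eq' (hr.adjoint_A_A y)
  have h4 : resolventAt (adjoint r.A) (1 / z) (r.A y - (1 / z) • adjoint r.A (r.A y)) = r.A y :=
    hs.dual.isStableOperator.resolventAt_sub hz' _
  have h5 : y - adjoint r.A (r.A y) =
      x + z • (r.A y - (1 / z) • adjoint r.A (r.A y)) := by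
    rw [← h1, smul_sub, smul_smul, mul_one_div_cancel hz0, one_smul]
    abel
  rw [h2, h3, h5, map_add, map_smul, h4, map_add, map_smul, smul_add, smul_smul,
    one_div_mul_cancel hz0, one_smul]
  abel

theorem dual_transferFunction_mul {r : Realization X E} (hs : r.IsStable)
    (hr : r.IsUnitary) {z : ℂ} (hz : ‖z‖ = 1) :
    r.dual.transferFunction (1 / z) * r.transferFunction z = 1 := by
  have hz0 : z ≠ 0 := by rintro rfl; simp at hz
  have hz' : ‖1 / z‖ ≤ 1 := by simp [hz]
  ext u
  rw [mul_apply_eq_comp, transferFunction_apply r, map_add, map_smul,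
    dual_transferFunction_resolventAt hs hr hz, smul_smul, mul_one_div_cancel hz0, one_smul,
    transferFunction_apply]
  simp only [Realization.dual]
  have h2 : adjoint r.C (r.D u) = - adjoint r.A (r.B u) :=
    eq_neg_of_add_eq_zero_right (hr.adjoint_A_B u)
  have h3 : resolventAt (adjoint r.A) (1 / z) (r.B u - (1 / z) • adjoint r.A (r.B u)) = r.B u :=
    hs.dual.isStableOperator.resolventAt_sub hz' _
  rw [map_sub, map_smul, sub_eq_iff_eq_add] at h3
  rw [h2, map_neg, map_neg, smul_neg, h3, map_add, map_smul]
  conv_rhs => rw [one_apply_eq_self, ← hr.adjoint_B_B u]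
  abel

theorem transferFunction_mul_dual {r : Realization X E} (hs : r.IsStable)
    (hr : r.IsUnitary) {z : ℂ} (hz : ‖z‖ = 1) :
    r.transferFunction z * r.dual.transferFunction (1 / z) = 1 := by
  have := dual_transferFunction_mul hs.dual hr.dual (z := 1 / z) (by simp [hz])
  rwa [dual_dual, one_div_one_div] at this

/-- The unobservable subspace is invariant under $A$, and on it $\|Ax\|^2+\|Cx\|^2=\|x\|^2$ makes
$A$ isometric. An eigenvector there would have an eigenvalue of modulus one, against stability. -/
theorem eq_zero_of_unobservable {r : Realization X E} (hs : r.IsStable)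
    (hr : r.IsUnitary) {x : X} (hx : ∀ n : ℕ, r.C ((r.A ^ n) x) = 0) : x = 0 := by
  let K : Submodule ℂ X := ⨅ n : ℕ, LinearMap.ker (r.C ∘L r.A ^ n).toLinearMap
  have hK : ∀ y, y ∈ K ↔ ∀ n : ℕ, r.C ((r.A ^ n) y) = 0 := fun y => by
    simp only [K, Submodule.mem_iInf, LinearMap.mem_ker, ContinuousLinearMap.coe_coe,
      ContinuousLinearMap.comp_apply]
  have hinv : ∀ y ∈ K, r.A.toLinearMap y ∈ K := fun y hy => by
    rw [hK] at hy ⊢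
    intro n
    have := hy (n + 1)
    rwa [pow_succ] at this
  by_contra hne
  have : Nontrivial K := ⟨⟨⟨x, (hK x).2 hx⟩, 0, fun h => hne (congrArg Subtype.val h)⟩⟩
  obtain ⟨μ, hμ⟩ := Module.End.exists_eigenvalue (r.A.toLinearMap.restrict hinv)
  obtain ⟨y, hy⟩ := hμ.exists_hasEigenvector
  have hy0 : y.1 ≠ 0 := fun h => hy.2 (Subtype.ext h)
  have h1 : r.A y.1 = μ • y.1 := congrArg Subtype.val hy.apply_eq_smul
  have h2 := hs.isStableOperator.norm_lt_one hy0 h1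
  have h3 := hr.norm_sq y.1
  have h4 : r.C y.1 = 0 := by simpa using (hK _).1 y.2 0
  rw [h4, h1, norm_smul] at h3
  have h5 : 0 < ‖y.1‖ := norm_pos_iff.2 hy0
  have h6 : 0 ≤ ‖μ‖ := norm_nonneg μ
  have h7 : ‖μ‖ * ‖y.1‖ < ‖y.1‖ := by nlinarith
  have h8 : 0 ≤ ‖μ‖ * ‖y.1‖ := by positivity
  rw [norm_zero] at h3
  nlinarith

end Dual

end Realization

/-! ### The operators $\Omega_*$, $C_{\circ*}$, $Q_*$ and the kernel of $I-A_v^kQ_*A_v^{*k}$. -/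

section Pair

variable {E Xv Xw : Type*}
  [NormedAddCommGroup E] [InnerProductSpace ℂ E] [CompleteSpace E]
  [NormedAddCommGroup Xv] [InnerProductSpace ℂ Xv] [CompleteSpace Xv]
  [NormedAddCommGroup Xw] [InnerProductSpace ℂ Xw] [CompleteSpace Xw]
  {v : Realization Xv E} {w : Realization Xw E} {Ω : Xv →L[ℂ] Xw} {C : Xv →L[ℂ] E}
  {Q : Xv →L[ℂ] Xv}

/-- Substituting the Stein equation for $Q$ once more adds the term $A^kC^*CA^{*k}$; the starting
term is $I-Q=\Omega^*\Omega$. -/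
theorem inner_defect (hQ : Q = v.A ∘L Q ∘L adjoint v.A + adjoint C ∘L C)
    (hQΩ : Q = 1 - adjoint Ω ∘L Ω) (k : ℕ) (x : Xv) :
    ⟪(1 - v.A ^ k * Q * adjoint v.A ^ k) x, x⟫_ℂ =
      ⟪Ω x, Ω x⟫_ℂ +
        ∑ i ∈ Finset.range k, ⟪C ((adjoint v.A ^ i) x), C ((adjoint v.A ^ i) x)⟫_ℂ := by
  induction k with
  | zero =>
    simp [hQΩ, ContinuousLinearMap.adjoint_inner_left]
  | succ k ih =>
    rw [Finset.sum_range_succ, ← add_assoc, ← ih]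
    have hadj : adjoint (v.A ^ k) = adjoint v.A ^ k := by
      simp only [← ContinuousLinearMap.star_eq_adjoint, star_pow]
    have h1 : v.A ^ k * Q * adjoint v.A ^ k = v.A ^ (k + 1) * Q * adjoint v.A ^ (k + 1)
        + v.A ^ k * (adjoint C ∘L C) * adjoint v.A ^ k := by
      have h2 : Q = v.A * Q * adjoint v.A + adjoint C ∘L C := hQ
      conv_lhs => rw [h2]
      rw [pow_succ, pow_succ' (adjoint v.A)]
      noncomm_ring
    rw [h1, ← hadj]
    simp only [sub_apply, add_apply, inner_sub_left, inner_add_left, mul_apply_eq_comp,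
      ContinuousLinearMap.comp_apply]
    rw [← ContinuousLinearMap.adjoint_inner_right (v.A ^ k) (adjoint C _),
      ContinuousLinearMap.adjoint_inner_left C]
    ring

theorem mem_ker_defect (hQ : Q = v.A ∘L Q ∘L adjoint v.A + adjoint C ∘L C)
    (hQΩ : Q = 1 - adjoint Ω ∘L Ω) (k : ℕ) (x : Xv) :
    x ∈ LinearMap.ker (1 - v.A ^ k * Q * adjoint v.A ^ k : Xv →L[ℂ] Xv).toLinearMap ↔
      Ω x = 0 ∧ ∀ i < k, C ((adjoint v.A ^ i) x) = 0 := by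
  rw [LinearMap.mem_ker, ContinuousLinearMap.coe_coe]
  constructor
  · intro h
    have h1 := inner_defect hQ hQΩ k x
    rw [h, inner_zero_left] at h1
    have h2 := congrArg RCLike.re h1.symm
    simp only [map_add, map_sum, inner_self_eq_norm_sq, map_zero] at h2
    have h3 : 0 ≤ ∑ i ∈ Finset.range k, ‖C ((adjoint v.A ^ i) x)‖ ^ 2 :=
      Finset.sum_nonneg fun i _ => by positivity
    have h4 : 0 ≤ ‖Ω x‖ ^ 2 := by positivity
    have h5 : ‖Ω x‖ ^ 2 = 0 := by linarith
    have h6 : ∑ i ∈ Finset.range k, ‖C ((adjoint v.A ^ i) x)‖ ^ 2 = 0 := by linarith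
    rw [Finset.sum_eq_zero_iff_of_nonneg fun i _ => by positivity] at h6
    exact ⟨by simpa using h5, fun i hi => by simpa using h6 i (Finset.mem_range.2 hi)⟩
  · rintro ⟨h1, h2⟩
    -- For the converse no positivity is needed: once the terms with $C$ vanish on $x$, each power
    -- $k$ reduces to the previous one, down to $Qx=x$.
    have hA : ∀ k : ℕ, (∀ i < k, C ((adjoint v.A ^ i) x) = 0) →
        (v.A ^ k * Q * adjoint v.A ^ k) x = x := by
      intro k
      induction k with
      | zero => intro _; simp [hQΩ, h1]
      | succ k ih =>
        intro h
        have h2 : Q = v.A * Q * adjoint v.A + adjoint C ∘L C := hQ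
        have h3 : v.A ^ (k + 1) * Q * adjoint v.A ^ (k + 1) =
            v.A ^ k * (Q - adjoint C ∘L C) * adjoint v.A ^ k := by
          rw [sub_eq_iff_eq_add.2 h2, pow_succ, pow_succ' (adjoint v.A)]
          noncomm_ring
        rw [h3, mul_sub, sub_mul, sub_apply, ih fun i hi => h i (by omega)]
        simp only [mul_apply_eq_comp, ContinuousLinearMap.comp_apply, h k (by omega), map_zero,
          sub_zero]
    rw [sub_apply, hA k h2, one_apply_eq_self, sub_self]

variable [FiniteDimensional ℂ Xv] [FiniteDimensional ℂ Xw]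

omit [CompleteSpace Xw] in
-- This explains the two defining equations: $\Omega y$ and $Cy$ are the state and output of the
-- system $w$ for the state $\Omega A_v^*y$ and input $B_v^*y$. Eliminating the state splits the
-- product into a part analytic in the disc, governed by $\Omega x$, and a part analytic outside,
-- governed by $C$.
theorem transferFunction_resolventAt_adjoint
    (hv : v.IsStable) (hw : w.IsStable)
    (hΩ : Ω = w.A ∘L Ω ∘L adjoint v.A + w.B ∘L adjoint v.B)
    (hC : C = w.D ∘L adjoint v.B + w.C ∘L Ω ∘L adjoint v.A) {z : ℂ} (hz : ‖z‖ = 1) (x : Xv) :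
    w.transferFunction z ((1 / z) • adjoint v.B (resolventAt (adjoint v.A) (1 / z) x)) =
      w.C (resolventAt w.A z (Ω x)) + (1 / z) • C (resolventAt (adjoint v.A) (1 / z) x) := by
  have hz0 : z ≠ 0 := by rintro rfl; simp at hz
  have hz' : ‖1 / z‖ ≤ 1 := by simp [hz]
  have h1 := hv.dual.isStableOperator.sub_resolventAt hz' x
  change resolventAt (adjoint v.A) (1 / z) x
    - (1 / z) • adjoint v.A (resolventAt (adjoint v.A) (1 / z) x) = x at h1
  set y := resolventAt (adjoint v.A) (1 / z) x
  set t := Ω (adjoint v.A y)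
  have h2 : C y = w.D (adjoint v.B y) + w.C t := DFunLike.congr_fun hC y
  have h3 : Ω y = w.A t + w.B (adjoint v.B y) := DFunLike.congr_fun hΩ y
  have h4 : Ω x = Ω y - (1 / z) • t := by
    rw [← h1, map_sub, map_smul]
  have h5 := hw.isStableOperator.resolventAt_sub hz.le ((1 / z) • t)
  have h6 : (1 / z) • t - z • w.A ((1 / z) • t) = w.B (adjoint v.B y) - Ω x := by
    rw [h4, h3, map_smul, smul_smul, mul_one_div_cancel hz0, one_smul]
    abel
  rw [h6, map_sub, sub_eq_iff_eq_add] at h5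
  rw [Realization.transferFunction_apply, map_smul, map_smul, map_smul, map_smul, smul_smul,
    mul_one_div_cancel hz0, one_smul, h5, h2, map_add, map_smul, smul_add]
  abel

omit [FiniteDimensional ℂ Xw] in
-- By uniqueness it is enough that $I-\Omega^*\Omega$ solves the equation for $Q$. The pair $(\Omega
-- x,Cx)$ is the image of $(\Omega A_v^*x,B_v^*x)$ under the unitary systems operator of $w$, so
-- inner products agree; then $A_vA_v^*+B_vB_v^*=I$ removes $B_v$.
theorem stein_solution_eq (hv : v.IsStable) (hvu : v.IsUnitary) (hwu : w.IsUnitary)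
    (hΩ : Ω = w.A ∘L Ω ∘L adjoint v.A + w.B ∘L adjoint v.B)
    (hC : C = w.D ∘L adjoint v.B + w.C ∘L Ω ∘L adjoint v.A)
    (hQ : Q = v.A ∘L Q ∘L adjoint v.A + adjoint C ∘L C) :
    Q = 1 - adjoint Ω ∘L Ω := by
  refine (hv.isStableOperator.existsUnique_stein hv.isStableOperator _).unique hQ ?_
  apply ContinuousLinearMap.ext
  intro x
  apply ext_inner_right ℂ
  intro y
  have h1 : ∀ y, Ω y = w.A (Ω (adjoint v.A y)) + w.B (adjoint v.B y) := DFunLike.congr_fun hΩ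
  have h2 : ∀ y, C y = w.D (adjoint v.B y) + w.C (Ω (adjoint v.A y)) := DFunLike.congr_fun hC
  have h3 : ⟪x, y⟫_ℂ = ⟪adjoint v.A x, adjoint v.A y⟫_ℂ + ⟪adjoint v.B x, adjoint v.B y⟫_ℂ := by
    conv_lhs => rw [← hvu.A_adjoint_A x]
    rw [inner_add_left, ContinuousLinearMap.adjoint_inner_right,
      ContinuousLinearMap.adjoint_inner_right]
  have h4 : ∀ (a c : Xw) (b d : E), ⟪w.A a + w.B b, w.A c + w.B d⟫_ℂ
      + ⟪w.C a + w.D b, w.C c + w.D d⟫_ℂ = ⟪a, c⟫_ℂ + ⟪b, d⟫_ℂ := fun a c b d => by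
    have h5 := hwu.dual_apply a b
    calc _ = ⟪adjoint w.A (w.A a + w.B b) + adjoint w.C (w.C a + w.D b), c⟫_ℂ
          + ⟪adjoint w.B (w.A a + w.B b) + adjoint w.D (w.C a + w.D b), d⟫_ℂ := ?_
      _ = _ := by rw [h5.1, h5.2]
    simp only [inner_add_left, inner_add_right, ContinuousLinearMap.adjoint_inner_left]
    ring
  have h5 := h4 (Ω (adjoint v.A x)) (Ω (adjoint v.A y)) (adjoint v.B x) (adjoint v.B y)
  rw [← h1, ← h1, add_comm (w.C _), add_comm (w.C _), ← h2, ← h2] at h5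
  simp only [sub_apply, one_apply_eq_self, ContinuousLinearMap.comp_apply,
    add_apply, map_sub, inner_sub_left, inner_add_left,
    ContinuousLinearMap.adjoint_inner_left]
  simp only [← ContinuousLinearMap.adjoint_inner_right v.A,
    ContinuousLinearMap.adjoint_inner_left Ω, h3]
  linear_combination (-1 : ℂ) * h5

end Pair

/-! ### Analyticity of operator functions applied to vector functions. -/

section Analytic

variable {E F : Type*} [NormedAddCommGroup E] [NormedSpace ℂ E]
  [NormedAddCommGroup F] [NormedSpace ℂ F]

theorem AnalyticOnNhd.clm_apply [CompleteSpace E] [CompleteSpace F]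
    {M : ℂ → E →L[ℂ] F} {f : ℂ → E} {s : Set ℂ}
    (hM : AnalyticOnNhd ℂ M s) (hf : AnalyticOnNhd ℂ f s) :
    AnalyticOnNhd ℂ (fun z => M z (f z)) s := fun z hz => by
  rw [Complex.analyticAt_iff_eventually_differentiableAt]
  filter_upwards [(hM z hz).eventually_analyticAt, (hf z hz).eventually_analyticAt] with y h1 h2
  exact h1.differentiableAt.clm_apply h2.differentiableAt

theorem AnalyticOnNhd.clm_const_apply {f : ℂ → E} {s : Set ℂ} (L : E →L[ℂ] F)
    (hf : AnalyticOnNhd ℂ f s) :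
    AnalyticOnNhd ℂ (fun z => L (f z)) s := fun z hz => (L.analyticAt _).fun_comp (hf z hz)

end Analytic

/-! ### Reflected adjoints, which preserve plus factors. -/

section Reflect

variable {E : Type*} [NormedAddCommGroup E] [InnerProductSpace ℂ E] [CompleteSpace E]

/-- `z ↦ F(conj z)^*`. -/
def reflect (F : ℂ → E →L[ℂ] E) (z : ℂ) : E →L[ℂ] E := adjoint (F (starRingEnd ℂ z))

theorem AnalyticOnNhd.reflect {F : ℂ → E →L[ℂ] E} (hF : AnalyticOnNhd ℂ F (closedBall 0 1)) :
    AnalyticOnNhd ℂ (reflect F) (closedBall 0 1) := fun z hz => by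
  have hz' : starRingEnd ℂ z ∈ closedBall (0 : ℂ) 1 := by simpa using hz
  rw [Complex.analyticAt_iff_eventually_differentiableAt]
  have h1 := (hF _ hz').eventually_analyticAt
  have h2 := (Complex.continuous_conj.tendsto z).eventually h1
  filter_upwards [h2] with y hy
  have h3 := hy.differentiableAt.star_star
  rwa [← starRingEnd_apply, starRingEnd_self_apply] at h3

theorem reflect_mul_reflect {F G : ℂ → E →L[ℂ] E}
    (h : ∀ z ∈ closedBall (0 : ℂ) 1, F z * G z = 1) {z : ℂ} (hz : z ∈ closedBall (0 : ℂ) 1) :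
    reflect G z * reflect F z = 1 := by
  have := congrArg star (h (starRingEnd ℂ z) (by simpa using hz))
  rwa [star_mul, star_one] at this

end Reflect

theorem conj_eq_one_div {z : ℂ} (hz : ‖z‖ = 1) : starRingEnd ℂ z = 1 / z := by
  rw [one_div, Complex.inv_def, Complex.normSq_eq_norm_sq, hz]
  simp

theorem conj_zpow {z : ℂ} (hz : ‖z‖ = 1) (n : ℤ) : starRingEnd ℂ (z ^ n) = z ^ (-n) := by
  rw [map_zpow₀, conj_eq_one_div hz, one_div, inv_zpow, zpow_neg]

/-! ### Coordinates in which the adjoint of the diagonal factor is diagonal. -/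

section Coordinates

variable {E : Type*} [NormedAddCommGroup E] [InnerProductSpace ℂ E] [FiniteDimensional ℂ E]

/-- The coordinates `⟪b j, y⟫` of a vector `y`. -/
def innerCoords (b : Module.Basis (Fin (Module.finrank ℂ E)) ℂ E) :
    E ≃L[ℂ] (Fin (Module.finrank ℂ E) → ℂ) :=
  (LinearEquiv.ofBijective (LinearMap.pi fun j => (innerSL ℂ (b j)).toLinearMap) (by
    have hi : Function.Injective
        (LinearMap.pi fun j => (innerSL ℂ (b j)).toLinearMap : E →ₗ[ℂ] _ → ℂ) := by
      intro x y h
      exact InnerProductSpace.ext_inner_left_basis b fun i => congrFun h i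
    exact ⟨hi, (LinearMap.injective_iff_surjective_of_finrank_eq_finrank (by simp)).1
      hi⟩)).toContinuousLinearEquiv

theorem innerCoords_apply (b : Module.Basis (Fin (Module.finrank ℂ E)) ℂ E) (y : E)
    (j : Fin (Module.finrank ℂ E)) : innerCoords b y j = ⟪b j, y⟫_ℂ := rfl

theorem diagPow_basis {m : ℕ} (b : Module.Basis (Fin m) ℂ E) (κ : Fin m → ℤ) (z : ℂ) (j : Fin m) :
    diagPow b κ z (b j) = z ^ κ j • b j := by
  change Matrix.toLin b b (Matrix.diagonal fun j => z ^ κ j) (b j) = _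
  rw [Matrix.toLin_self]
  simp [Matrix.diagonal_apply, ite_smul]

/-- The basis need not be orthonormal. The adjoint is diagonal in the dual basis, hence the
coordinates $\langle b_j,y\rangle$ instead of those given by $b$. -/
theorem innerCoords_adjoint_diagPow [CompleteSpace E]
    (b : Module.Basis (Fin (Module.finrank ℂ E)) ℂ E)
    (κ : Fin (Module.finrank ℂ E) → ℤ) {z : ℂ} (hz : ‖z‖ = 1) (y : E)
    (j : Fin (Module.finrank ℂ E)) :
    innerCoords b (adjoint (diagPow b κ z) y) j = z ^ (-κ j) * innerCoords b y j := by
  rw [innerCoords_apply, innerCoords_apply, ContinuousLinearMap.adjoint_inner_right, diagPow_basis,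
    inner_smul_left, conj_zpow hz]

end Coordinates

/-! ### The adjoint symbol on functions coming from the state space. -/

section Pair

variable {E Xv Xw : Type*}
  [NormedAddCommGroup E] [InnerProductSpace ℂ E] [CompleteSpace E]
  [NormedAddCommGroup Xv] [InnerProductSpace ℂ Xv] [FiniteDimensional ℂ Xv] [CompleteSpace Xv]
  [NormedAddCommGroup Xw] [InnerProductSpace ℂ Xw] [FiniteDimensional ℂ Xw] [CompleteSpace Xw]
  {v : Realization Xv E} {w : Realization Xw E} {Ω : Xv →L[ℂ] Xw} {C : Xv →L[ℂ] E}

/-- The adjoint `W(z) V^*(z)` of `V(z) W^*(z)` on the unit circle. -/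
def adjointSymbol (v : Realization Xv E) (w : Realization Xw E) (z : ℂ) : E →L[ℂ] E :=
  w.transferFunction z * v.dual.transferFunction (1 / z)

omit [FiniteDimensional ℂ Xv] [FiniteDimensional ℂ Xw] [CompleteSpace Xw] in
theorem adjoint_eq_adjointSymbol {R : ℂ → E →L[ℂ] E} (hR : ∀ z : ℂ, ‖z‖ = 1 →
      R z = v.transferFunction z ∘L paraAdjoint w.transferFunction z) {z : ℂ} (hz : ‖z‖ = 1) :
    adjoint (R z) = adjointSymbol v w z := by
  rw [hR z hz, ContinuousLinearMap.adjoint_comp, paraAdjoint,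
    ContinuousLinearMap.adjoint_adjoint, Realization.adjoint_transferFunction,
    conj_eq_one_div hz, one_div_one_div]
  rfl

omit [CompleteSpace Xw] in
theorem adjointSymbol_resolventAt (hv : v.IsStable) (hvu : v.IsUnitary) (hw : w.IsStable)
    (hΩ : Ω = w.A ∘L Ω ∘L adjoint v.A + w.B ∘L adjoint v.B)
    (hC : C = w.D ∘L adjoint v.B + w.C ∘L Ω ∘L adjoint v.A) {z : ℂ} (hz : ‖z‖ = 1) (x : Xv) :
    adjointSymbol v w z (v.C (resolventAt v.A z x)) =
      w.C (resolventAt w.A z (Ω x)) + (1 / z) • C (resolventAt (adjoint v.A) (1 / z) x) := by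
  rw [adjointSymbol, mul_apply_eq_comp,
    Realization.dual_transferFunction_resolventAt hv hvu hz,
    transferFunction_resolventAt_adjoint hv hw hΩ hC hz]

theorem norm_eq_one_of_mem_sphere {z : ℂ} (hz : z ∈ sphere (0 : ℂ) 1) : ‖z‖ = 1 := by
  simpa using hz

theorem mem_closedBall_of_norm_eq_one {z : ℂ} (hz : ‖z‖ = 1) : z ∈ closedBall (0 : ℂ) 1 := by
  simp [hz]

theorem one_div_mem_closedBall {z : ℂ} (hz : ‖z‖ = 1) : 1 / z ∈ closedBall (0 : ℂ) 1 := by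
  simp [hz]

/-- Analytic functions mapped by the symbol into functions that are analytic outside the disc and
vanish at infinity come from the state space. -/
theorem exists_state_of_adjointSymbol_eq (hv : v.IsStable) (hvu : v.IsUnitary) (hw : w.IsStable)
    (hwu : w.IsUnitary) {f g : ℂ → E} (hf : AnalyticOnNhd ℂ f (closedBall 0 1))
    (hg : AnalyticOnNhd ℂ g (closedBall 0 1))
    (h : ∀ z : ℂ, ‖z‖ = 1 → adjointSymbol v w z (f z) = (1 / z) • g (1 / z)) :
    ∃ x : Xv, ∀ z : ℂ, ‖z‖ = 1 → f z = v.C (resolventAt v.A z x) := by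
  -- On the circle $f=VW^*(z^{-1}g(1/z))$, so $f=z^{-1}V(z)p(1/z)$. The feedthrough part is $q(1/z)$
  -- and the rest is $Cy$.
  let p : ℂ → E := fun u => w.dual.transferFunction u (g u)
  have hp : AnalyticOnNhd ℂ p (closedBall 0 1) :=
    AnalyticOnNhd.clm_apply hw.dual.analyticOnNhd_transferFunction hg
  let q : ℂ → E := fun u => u • v.D (p u)
  have hq : AnalyticOnNhd ℂ q (closedBall 0 1) := fun u hu =>
    analyticAt_id.smul (AnalyticOnNhd.clm_const_apply v.D hp u hu)
  let y : ℂ → Xv := fun z => resolventAt v.A z (v.B (p (1 / z)))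
  have hBp : ContinuousOn (fun z => v.B (p (1 / z))) (sphere 0 1) :=
    v.B.continuous.comp_continuousOn (AnalyticOnNhd.continuousOn_sphere_inv hp)
  have hy : ContinuousOn y (sphere 0 1) :=
    (AnalyticOnNhd.continuousOn_sphere hv.isStableOperator.analyticOnNhd_resolventAt).clm_apply hBp
  have hfy : Set.EqOn f (fun z => q (1 / z) + v.C (y z)) (sphere 0 1) := fun z hz => by
    have hz1 := norm_eq_one_of_mem_sphere hz
    have hz0 := ne_zero_of_mem_sphere hz
    have h1 := congrArg (fun t => v.transferFunction z (w.dual.transferFunction (1 / z) t))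
      (h z hz1)
    simp only [adjointSymbol] at h1
    have h2 : ∀ t, w.dual.transferFunction (1 / z) (w.transferFunction z t) = t := fun t =>
      DFunLike.congr_fun (Realization.dual_transferFunction_mul hw hwu hz1) t
    have h3 : ∀ t, v.transferFunction z (v.dual.transferFunction (1 / z) t) = t := fun t =>
      DFunLike.congr_fun (Realization.transferFunction_mul_dual hv hvu hz1) t
    rw [mul_apply_eq_comp, h2, h3, map_smul, map_smul] at h1
    rw [h1, Realization.transferFunction_apply, smul_add, smul_smul, one_div_mul_cancel hz0,
      one_smul]
  -- In $y=Bp(1/z)+zAy$ the first term has no coefficients of positive index, so the coefficients of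
  -- $y$ follow the orbit of $y_0$ under $A$. Hence $y_0$ is the required state.
  have hrec : ∀ n : ℕ, laurentCoeff (n : ℤ) y = (v.A ^ n) (laurentCoeff 0 y) := fun n => by
    induction n with
    | zero => simp
    | succ n ih =>
      have h1 : Set.EqOn y (fun z => v.B (p (1 / z)) + z ^ (1 : ℤ) • v.A (y z)) (sphere 0 1) :=
        fun z hz => by
          simp only [zpow_one]
          rw [← sub_eq_iff_eq_add]
          exact hv.isStableOperator.sub_resolventAt (norm_eq_one_of_mem_sphere hz).le _
      have hAy : ContinuousOn (fun z => v.A (y z)) (sphere 0 1) :=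
        v.A.continuous.comp_continuousOn hy
      have hzAy : ContinuousOn (fun z : ℂ => z ^ (1 : ℤ) • v.A (y z)) (sphere 0 1) :=
        (continuousOn_zpow_sphere 1).smul hAy
      have h2 : laurentCoeff ((n + 1 : ℕ) : ℤ) (fun z => v.B (p (1 / z))) = 0 :=
        laurentCoeff_pos_of_analyticOnNhd_inv (g := fun u => v.B (p u))
          (AnalyticOnNhd.clm_const_apply v.B hp) (by positivity)
      rw [laurentCoeff_congr h1, laurentCoeff_add hBp hzAy, laurentCoeff_zpow_smul,
        laurentCoeff_map v.A hy, h2, zero_add]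
      have h3 : ((n + 1 : ℕ) : ℤ) - 1 = n := by push_cast; ring
      rw [h3, ih, pow_succ']
      rfl
  have hCy : ContinuousOn (fun z => v.C (y z)) (sphere 0 1) := v.C.continuous.comp_continuousOn hy
  refine ⟨laurentCoeff 0 y, fun z hz => ?_⟩
  have hfx := hv.isStableOperator.analyticOnNhd_resolventAt_apply v.C (laurentCoeff 0 y)
  refine eqOn_of_laurentCoeff (AnalyticOnNhd.continuousOn_sphere hf)
    (AnalyticOnNhd.continuousOn_sphere hfx) (fun n => ?_) (by simpa using hz)
  rcases lt_or_ge n 0 with hn | hn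
  · rw [laurentCoeff_neg_of_analyticOnNhd hf hn, laurentCoeff_neg_of_analyticOnNhd hfx hn]
  · obtain ⟨k, rfl⟩ := Int.eq_ofNat_of_zero_le hn
    rw [hv.isStableOperator.laurentCoeff_resolventAt, laurentCoeff_congr hfy,
      laurentCoeff_add (AnalyticOnNhd.continuousOn_sphere_inv hq) hCy, laurentCoeff_map v.C hy,
      hrec k, add_eq_right, laurentCoeff_comp_inv]
    -- The factor $u$ in $q$ matters only for index $0$, where it makes the coefficient $q(0)$
    -- vanish.
    rcases Nat.eq_zero_or_pos k with rfl | hk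
    · simp only [Nat.cast_zero, neg_zero]
      rw [laurentCoeff_zero_of_analyticOnNhd hq]
      simp [q]
    · exact laurentCoeff_neg_of_analyticOnNhd hq (by simpa using hk)

theorem eq_of_resolventAt_eq (hv : v.IsStable) (hvu : v.IsUnitary) {x y : Xv}
    (h : ∀ z : ℂ, ‖z‖ = 1 → v.C (resolventAt v.A z x) = v.C (resolventAt v.A z y)) : x = y := by
  rw [← sub_eq_zero]
  refine Realization.eq_zero_of_unobservable hv hvu fun n => ?_
  rw [map_sub, map_sub, ← hv.isStableOperator.laurentCoeff_resolventAt,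
    ← hv.isStableOperator.laurentCoeff_resolventAt, sub_eq_zero]
  exact laurentCoeff_congr (fun z hz => h z (norm_eq_one_of_mem_sphere hz)) _

omit [CompleteSpace E] [CompleteSpace Xv] in
theorem resolventAt_eq_of_forall_lt {T : Xv →L[ℂ] Xv} (hT : IsStableOperator T) {k : ℕ} {x : Xv}
    (h : ∀ i < k, C ((T ^ i) x) = 0) {u : ℂ} (hu : ‖u‖ ≤ 1) :
    C (resolventAt T u x) = u ^ k • C (resolventAt T u ((T ^ k) x)) := by
  induction k with
  | zero => simp
  | succ k ih =>
    rw [ih fun i hi => h i (by omega)]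
    have h1 : resolventAt T u ((T ^ k) x) =
        (T ^ k) x + u • resolventAt T u ((T ^ (k + 1)) x) := by
      rw [pow_succ', ← sub_eq_iff_eq_add, ← map_smul, ← map_sub]
      exact hT.resolventAt_sub hu _
    rw [h1, map_add, h k (by omega), zero_add, map_smul, smul_smul, ← pow_succ]

/-- The two summands of `adjointSymbol_resolventAt` have disjoint Fourier support: index $n\ge0$
carries $C_wA_w^n\Omega x$ and index $-i-1$ carries $CA_v^{*i}x$. Vanishing of all indices above
$-k-1$ is the condition on the left, observability of $w$ giving $\Omega x=0$. -/
theorem mem_defect_iff (hv : v.IsStable) (hvu : v.IsUnitary) (hw : w.IsStable) (hwu : w.IsUnitary)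
    (hΩ : Ω = w.A ∘L Ω ∘L adjoint v.A + w.B ∘L adjoint v.B)
    (hC : C = w.D ∘L adjoint v.B + w.C ∘L Ω ∘L adjoint v.A) (k : ℕ) (x : Xv) :
    (Ω x = 0 ∧ ∀ i < k, C ((adjoint v.A ^ i) x) = 0) ↔
      ∃ g : ℂ → E, AnalyticOnNhd ℂ g (closedBall 0 1) ∧ ∀ z : ℂ, ‖z‖ = 1 →
        adjointSymbol v w z (v.C (resolventAt v.A z x)) = z ^ (-(k : ℤ) - 1) • g (1 / z) := by
  have hT : IsStableOperator (adjoint v.A) := hv.dual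
  constructor
  · rintro ⟨h1, h2⟩
    refine ⟨fun u => C (resolventAt (adjoint v.A) u ((adjoint v.A ^ k) x)),
      hT.analyticOnNhd_resolventAt_apply C _, fun z hz => ?_⟩
    have hz0 : z ≠ 0 := by rintro rfl; simp at hz
    rw [adjointSymbol_resolventAt hv hvu hw hΩ hC hz, h1, map_zero, map_zero, zero_add,
      resolventAt_eq_of_forall_lt hT h2 (by simp [hz]), smul_smul]
    congr 1
    rw [← pow_succ', one_div, inv_pow, ← zpow_natCast, ← zpow_neg]
    congr 1
    push_cast
    ring
  · rintro ⟨g, hg, h⟩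
    have h1 := hw.isStableOperator.analyticOnNhd_resolventAt_apply w.C (Ω x)
    let q : ℂ → E := fun u => u • C (resolventAt (adjoint v.A) u x)
    have h2' := hT.analyticOnNhd_resolventAt_apply C x
    have h2 : AnalyticOnNhd ℂ q (closedBall 0 1) := fun u hu => analyticAt_id.smul (h2' u hu)
    have h3 : Set.EqOn (fun z => w.C (resolventAt w.A z (Ω x)) + q (1 / z))
        (fun z => z ^ (-(k : ℤ) - 1) • g (1 / z)) (sphere 0 1) := fun z hz => by
      have hz1 := norm_eq_one_of_mem_sphere hz
      simp only
      rw [← h z hz1, adjointSymbol_resolventAt hv hvu hw hΩ hC hz1]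
    have h4 : ∀ n : ℤ, -(k : ℤ) - 1 < n → laurentCoeff n
        (fun z => w.C (resolventAt w.A z (Ω x))) + laurentCoeff (-n) q = 0 := fun n hn => by
      rw [← laurentCoeff_comp_inv, ← laurentCoeff_add (AnalyticOnNhd.continuousOn_sphere h1)
        (AnalyticOnNhd.continuousOn_sphere_inv h2), laurentCoeff_congr h3, laurentCoeff_zpow_smul]
      exact laurentCoeff_pos_of_analyticOnNhd_inv hg (by omega)
    constructor
    · refine Realization.eq_zero_of_unobservable hw hwu fun n => ?_
      rw [← hw.isStableOperator.laurentCoeff_resolventAt]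
      have h5 := h4 n (by omega)
      have h6 : laurentCoeff (-(n : ℤ)) q = 0 := by
        rcases Nat.eq_zero_or_pos n with rfl | hn
        · simp only [Nat.cast_zero, neg_zero]
          rw [laurentCoeff_zero_of_analyticOnNhd h2]
          simp [q]
        · exact laurentCoeff_neg_of_analyticOnNhd h2 (by omega)
      rwa [h6, add_zero] at h5
    · intro i hi
      have h5 := h4 (-(i : ℤ) - 1) (by omega)
      rw [laurentCoeff_neg_of_analyticOnNhd h1 (by omega), zero_add] at h5
      have h6 : q = fun u => u ^ (1 : ℤ) • C (resolventAt (adjoint v.A) u x) := by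
        simp only [zpow_one, q]
      rw [h6, laurentCoeff_zpow_smul] at h5
      rw [← hT.laurentCoeff_resolventAt, ← h5]
      congr 1
      ring

end Pair

/-! ### Dimension count through the Wiener–Hopf factorization. -/

section Count

variable {E Xv Xw : Type*}
  [NormedAddCommGroup E] [InnerProductSpace ℂ E] [FiniteDimensional ℂ E] [CompleteSpace E]
  [NormedAddCommGroup Xv] [InnerProductSpace ℂ Xv] [FiniteDimensional ℂ Xv] [CompleteSpace Xv]
  [NormedAddCommGroup Xw] [InnerProductSpace ℂ Xw] [FiniteDimensional ℂ Xw] [CompleteSpace Xw]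
  {v : Realization Xv E} {w : Realization Xw E} {Ω : Xv →L[ℂ] Xw} {C : Xv →L[ℂ] E}
  {Q : Xv →L[ℂ] Xv}

/-- A scalar function that is analytic on the closed disc and equals `z ^ (n - 1)` times a function
analytic outside the disc is determined by its coefficients of index `0, …, n - 1`. -/
theorem laurentCoeff_eq_zero_of_not_mem {h g : ℂ → ℂ} (hh : AnalyticOnNhd ℂ h (closedBall 0 1))
    (hg : AnalyticOnNhd ℂ g (closedBall 0 1)) {n : ℤ}
    (hhg : ∀ z : ℂ, ‖z‖ = 1 → h z = z ^ (n - 1) * g (1 / z)) {i : ℤ} (hi : i < 0 ∨ n ≤ i) :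
    laurentCoeff i h = 0 := by
  rcases hi with hi | hi
  · exact laurentCoeff_neg_of_analyticOnNhd hh hi
  · have h1 : Set.EqOn h (fun z => z ^ (n - 1) • g (1 / z)) (sphere 0 1) := fun z hz =>
      hhg z (norm_eq_one_of_mem_sphere hz)
    rw [laurentCoeff_congr h1, laurentCoeff_zpow_smul]
    exact laurentCoeff_pos_of_analyticOnNhd_inv hg (by omega)

/-- The coefficients of index `0, …, n j - 1` of the coordinates of `M(z) C (I - z A)⁻¹ x`. -/
def coeffMap (v : Realization Xv E) (hv : v.IsStable)
    (b : Module.Basis (Fin (Module.finrank ℂ E)) ℂ E) {M : ℂ → E →L[ℂ] E}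
    (hM : AnalyticOnNhd ℂ M (closedBall 0 1)) (n : Fin (Module.finrank ℂ E) → ℕ) :
    Xv →ₗ[ℂ] ((j : Fin (Module.finrank ℂ E)) × Fin (n j)) → ℂ where
  toFun x := fun i => laurentCoeff ((i.2 : ℕ) : ℤ)
    (fun z => innerCoords b (M z (v.C (resolventAt v.A z x))) i.1)
  map_add' x y := by
    have hc : ∀ (x : Xv) j, ContinuousOn
        (fun z => innerCoords b (M z (v.C (resolventAt v.A z x))) j) (sphere 0 1) := fun x j =>
      (continuous_apply j).comp_continuousOn ((innerCoords b).continuous.comp_continuousOn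
        (AnalyticOnNhd.continuousOn_sphere (AnalyticOnNhd.clm_apply hM
          (hv.isStableOperator.analyticOnNhd_resolventAt_apply v.C x))))
    ext i
    simp only [map_add, Pi.add_apply]
    exact laurentCoeff_add (hc x i.1) (hc y i.1) _
  map_smul' c x := by
    ext i
    simp only [map_smul, Pi.smul_apply, RingHom.id_apply]
    exact laurentCoeff_smul c _ _

omit [CompleteSpace Xv] in
theorem coeffMap_apply (hv : v.IsStable)
    (b : Module.Basis (Fin (Module.finrank ℂ E)) ℂ E) {M : ℂ → E →L[ℂ] E}
    (hM : AnalyticOnNhd ℂ M (closedBall 0 1)) (n : Fin (Module.finrank ℂ E) → ℕ) (x : Xv)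
    (i : (j : Fin (Module.finrank ℂ E)) × Fin (n j)) :
    coeffMap v hv b hM n x i = laurentCoeff ((i.2 : ℕ) : ℤ)
      (fun z => innerCoords b (M z (v.C (resolventAt v.A z x))) i.1) := rfl

theorem laurentCoeff_polynomial {n : ℕ} (a : Fin n → ℂ) (i : Fin n) :
    laurentCoeff ((i : ℕ) : ℤ) (fun z => ∑ l : Fin n, z ^ ((l : ℕ) : ℤ) • a l) = a i := by
  have hc : ∀ l ∈ (Finset.univ : Finset (Fin n)), ContinuousOn
      (fun z : ℂ => z ^ ((l : ℕ) : ℤ) • a l) (sphere 0 1) := fun l _ =>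
    (continuousOn_zpow_sphere _).smul continuousOn_const
  rw [laurentCoeff_sum _ hc]
  simp only [laurentCoeff_zpow_smul_const]
  rw [Finset.sum_eq_single i]
  · simp
  · intro l _ hl
    rw [if_neg]
    intro h
    exact hl (Fin.ext (by exact_mod_cast h.symm))
  · simp

/-- The plus factors and their inverses preserve analyticity, so the condition on $f$ decouples into
scalar ones. The coordinates $h_j$ of $W_-^*f$ are analytic in the disc with $z^{-\kappa_j}h_j\in
z^{-k-1}\cdot$(analytic outside), that is, polynomials of degree less than $\kappa_j-k$. -/
theorem finrank_defect (hv : v.IsStable) (hvu : v.IsUnitary) (hw : w.IsStable) (hwu : w.IsUnitary)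
    (hΩ : Ω = w.A ∘L Ω ∘L adjoint v.A + w.B ∘L adjoint v.B)
    (hC : C = w.D ∘L adjoint v.B + w.C ∘L Ω ∘L adjoint v.A)
    {R : ℂ → E →L[ℂ] E} (hR : ∀ z : ℂ, ‖z‖ = 1 →
      R z = v.transferFunction z ∘L paraAdjoint w.transferFunction z)
    {κ : Fin (Module.finrank ℂ E) → ℤ} (hκ : HasWienerHopfIndices R κ) (k : ℕ)
    {N : Submodule ℂ Xv} (hN : ∀ x, x ∈ N ↔ Ω x = 0 ∧ ∀ i < k, C ((adjoint v.A ^ i) x) = 0) :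
    Module.finrank ℂ N = ∑ j, (κ j - k).toNat := by
  obtain ⟨b, Wm, Wp, ⟨M, ⟨hM, M', hM', hMM'⟩, hWm⟩, ⟨hP, P', hP', hPP'⟩, hfac⟩ := hκ
  simp only [mem_defect_iff hv hvu hw hwu hΩ hC] at hN
  have hM1 := AnalyticOnNhd.reflect hM
  have hM2 := AnalyticOnNhd.reflect hM'
  have hP1 := AnalyticOnNhd.reflect hP
  have hP2 := AnalyticOnNhd.reflect hP'
  have hM12 : ∀ z ∈ closedBall (0 : ℂ) 1, ∀ y, reflect M z (reflect M' z y) = y := fun z hz =>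
    DFunLike.congr_fun (reflect_mul_reflect (fun z hz => (hMM' z hz).2) hz)
  have hM21 : ∀ z ∈ closedBall (0 : ℂ) 1, ∀ y, reflect M' z (reflect M z y) = y := fun z hz =>
    DFunLike.congr_fun (reflect_mul_reflect (fun z hz => (hMM' z hz).1) hz)
  have hP21 : ∀ z ∈ closedBall (0 : ℂ) 1, ∀ y, reflect P' z (reflect Wp z y) = y := fun z hz =>
    DFunLike.congr_fun (reflect_mul_reflect (fun z hz => (hPP' z hz).1) hz)
  have hS : ∀ z : ℂ, ‖z‖ = 1 → ∀ y, adjointSymbol v w z y =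
      reflect Wp (1 / z) (adjoint (diagPow b κ z) (reflect M z y)) := fun z hz y => by
    have hz' : starRingEnd ℂ (1 / z) = z := by
      rw [← conj_eq_one_div hz, starRingEnd_self_apply]
    rw [← adjoint_eq_adjointSymbol hR hz, hfac z hz, hWm z hz.ge, reflect, reflect, hz',
      conj_eq_one_div hz]
    change star (M (1 / z) * diagPow b κ z * Wp z) y = _
    rw [star_mul, star_mul]
    rfl
  -- Truncation at $0$ is intended: an index $\kappa_j\le k$ allows only $h_j=0$.
  let n : Fin (Module.finrank ℂ E) → ℕ := fun j => (κ j - k).toNat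
  let Φ := coeffMap v hv b hM1 n ∘ₗ N.subtype
  have hfx : ∀ x, AnalyticOnNhd ℂ (fun z => v.C (resolventAt v.A z x)) (closedBall 0 1) := fun x =>
    hv.isStableOperator.analyticOnNhd_resolventAt_apply v.C x
  have hinj : Function.Injective Φ := by
    rw [← LinearMap.ker_eq_bot, LinearMap.ker_eq_bot']
    rintro ⟨x, hx⟩ hΦ
    obtain ⟨g, hg, hgz⟩ := (hN x).1 hx
    refine Subtype.ext (eq_of_resolventAt_eq hv hvu fun z hz => ?_)
    simp only [ZeroMemClass.coe_zero, map_zero]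
    rw [← hM21 z (mem_closedBall_of_norm_eq_one hz) (v.C (resolventAt v.A z x))]
    suffices h0 : innerCoords b (reflect M z (v.C (resolventAt v.A z x))) = 0 by
      rw [(innerCoords b).map_eq_zero_iff.1 h0, map_zero]
    ext j
    let L : E →L[ℂ] ℂ := (ContinuousLinearMap.proj j) ∘L (innerCoords b).toContinuousLinearMap
    have hh : AnalyticOnNhd ℂ (fun z => L (reflect M z (v.C (resolventAt v.A z x))))
        (closedBall 0 1) :=
      AnalyticOnNhd.clm_const_apply L (AnalyticOnNhd.clm_apply hM1 (hfx x))
    have hq : AnalyticOnNhd ℂ (fun u => L (reflect P' u (g u))) (closedBall 0 1) :=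
      AnalyticOnNhd.clm_const_apply L (AnalyticOnNhd.clm_apply hP2 hg)
    have hhq : ∀ z : ℂ, ‖z‖ = 1 → L (reflect M z (v.C (resolventAt v.A z x))) =
        z ^ ((κ j - k) - 1) * L (reflect P' (1 / z) (g (1 / z))) := fun z hz => by
      have hz0 : z ≠ 0 := by rintro rfl; simp at hz
      have h1 := hgz z hz
      rw [hS z hz] at h1
      have h2 := congrArg (fun y => L (reflect P' (1 / z) y)) h1
      simp only [hP21 _ (one_div_mem_closedBall hz), map_smul] at h2
      have h3 : ∀ y, L (adjoint (diagPow b κ z) y) = z ^ (-κ j) * L y := fun y =>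
        innerCoords_adjoint_diagPow b κ hz y j
      rw [h3, smul_eq_mul] at h2
      have h4 := congrArg (fun t => z ^ κ j * t) h2
      simp only [← mul_assoc, ← zpow_add₀ hz0] at h4
      rw [add_neg_cancel, zpow_zero, one_mul] at h4
      rw [h4]
      congr 2
      ring
    have hcoef : ∀ i : ℤ, laurentCoeff i
        (fun z => L (reflect M z (v.C (resolventAt v.A z x)))) = 0 := fun i => by
      by_cases hi : i < 0 ∨ κ j - k ≤ i
      · exact laurentCoeff_eq_zero_of_not_mem hh hq hhq hi
      · have hi0 : i = (i.toNat : ℤ) := by omega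
        have h1 := congrFun hΦ ⟨j, ⟨i.toNat, by simp only [n]; omega⟩⟩
        simp only [Φ, LinearMap.comp_apply, coeffMap_apply] at h1
        rw [hi0]
        exact h1
    exact eq_zero_of_laurentCoeff (AnalyticOnNhd.continuousOn_sphere hh) hcoef (by simpa using hz)
  have hsurj : Function.Surjective Φ := by
    intro a
    let h : ℂ → Fin (Module.finrank ℂ E) → ℂ := fun z j =>
      ∑ l : Fin (n j), z ^ (l : ℕ) * a ⟨j, l⟩
    -- The reversed polynomials, so that $h_j(z)=z^{n_j-1}p_j(1/z)$.
    let p : ℂ → Fin (Module.finrank ℂ E) → ℂ := fun u j =>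
      ∑ l : Fin (n j), u ^ (n j - 1 - (l : ℕ)) * a ⟨j, l⟩
    have hh : AnalyticOnNhd ℂ h (closedBall 0 1) := fun z _ =>
      analyticAt_pi_iff.2 fun j => Finset.analyticAt_fun_sum _ fun l _ =>
        (analyticAt_id.pow _).mul analyticAt_const
    have hp : AnalyticOnNhd ℂ p (closedBall 0 1) := fun z _ =>
      analyticAt_pi_iff.2 fun j => Finset.analyticAt_fun_sum _ fun l _ =>
        (analyticAt_id.pow _).mul analyticAt_const
    have hhp : ∀ z : ℂ, ‖z‖ = 1 → ∀ j, z ^ (-κ j) * h z j = z ^ (-(k : ℤ) - 1) * p (1 / z) j :=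
      fun z hz j => by
        have hz0 : z ≠ 0 := by rintro rfl; simp at hz
        simp only [h, p, Finset.mul_sum]
        refine Finset.sum_congr rfl fun l _ => ?_
        rw [← mul_assoc, ← mul_assoc, one_div, inv_pow, ← zpow_natCast, ← zpow_natCast, ← zpow_neg,
          ← zpow_add₀ hz0, ← zpow_add₀ hz0]
        congr 2
        have h1 := l.2
        have h2 : ((n j : ℕ) : ℤ) = κ j - k := by simp only [n] at h1 ⊢; omega
        have h3 : ((n j - 1 - (l : ℕ) : ℕ) : ℤ) = n j - 1 - l := by omega
        rw [h3, h2]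
        ring
    let f : ℂ → E := fun z => reflect M' z ((innerCoords b).symm (h z))
    have hf : AnalyticOnNhd ℂ f (closedBall 0 1) := AnalyticOnNhd.clm_apply hM2
      (AnalyticOnNhd.clm_const_apply (innerCoords b).symm.toContinuousLinearMap hh)
    let g : ℂ → E := fun u => reflect Wp u ((innerCoords b).symm (p u))
    have hg : AnalyticOnNhd ℂ g (closedBall 0 1) := AnalyticOnNhd.clm_apply hP1
      (AnalyticOnNhd.clm_const_apply (innerCoords b).symm.toContinuousLinearMap hp)
    have hMf : ∀ z : ℂ, ‖z‖ = 1 → innerCoords b (reflect M z (f z)) = h z := fun z hz => by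
      rw [hM12 z (mem_closedBall_of_norm_eq_one hz), ContinuousLinearEquiv.apply_symm_apply]
    have hSf : ∀ z : ℂ, ‖z‖ = 1 →
        adjointSymbol v w z (f z) = z ^ (-(k : ℤ) - 1) • g (1 / z) := fun z hz => by
      rw [hS z hz, ← map_smul]
      congr 1
      apply (innerCoords b).injective
      ext j
      rw [innerCoords_adjoint_diagPow b κ hz, hMf z hz, map_smul,
        ContinuousLinearEquiv.apply_symm_apply, Pi.smul_apply, smul_eq_mul, hhp z hz]
    -- The factor $z^{-k}$ is absorbed into the outside function, since the existence of a state
    -- only needs the decay $z^{-1}$.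
    have hg' : AnalyticOnNhd ℂ (fun u => u ^ k • g u) (closedBall 0 1) := fun u hu =>
      (analyticAt_id.pow k).smul (hg u hu)
    obtain ⟨x, hx⟩ := exists_state_of_adjointSymbol_eq hv hvu hw hwu hf hg' fun z hz => by
      have hz0 : z ≠ 0 := by rintro rfl; simp at hz
      rw [hSf z hz, smul_smul]
      congr 1
      rw [← pow_succ', one_div, inv_pow, ← zpow_natCast, ← zpow_neg]
      congr 1
      push_cast
      ring
    refine ⟨⟨x, (hN x).2 ⟨g, hg, fun z hz => by rw [← hx z hz, hSf z hz]⟩⟩, ?_⟩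
    ext ⟨j, l⟩
    simp only [Φ, LinearMap.comp_apply, coeffMap_apply, Submodule.subtype_apply]
    rw [← laurentCoeff_polynomial (fun l => a ⟨j, l⟩) l]
    refine laurentCoeff_congr (fun z hz => ?_) _
    have hz1 := norm_eq_one_of_mem_sphere hz
    rw [← hx z hz1, hMf z hz1]
    simp [h]
  rw [(LinearEquiv.ofBijective Φ ⟨hinj, hsurj⟩).finrank_eq]
  simp [n]

theorem defectDim_eq (hv : v.IsStable) (hvu : v.IsUnitary) (hw : w.IsStable) (hwu : w.IsUnitary)
    (hΩ : Ω = w.A ∘L Ω ∘L adjoint v.A + w.B ∘L adjoint v.B)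
    (hC : C = w.D ∘L adjoint v.B + w.C ∘L Ω ∘L adjoint v.A)
    (hQ : Q = v.A ∘L Q ∘L adjoint v.A + adjoint C ∘L C)
    {R : ℂ → E →L[ℂ] E} (hR : ∀ z : ℂ, ‖z‖ = 1 →
      R z = v.transferFunction z ∘L paraAdjoint w.transferFunction z)
    {κ : Fin (Module.finrank ℂ E) → ℤ} (hκ : HasWienerHopfIndices R κ) (k : ℕ) :
    defectDim v.A Q k = ∑ j, (κ j - k).toNat :=
  finrank_defect hv hvu hw hwu hΩ hC hR hκ k
    (mem_ker_defect hQ (stein_solution_eq hv hvu hwu hΩ hC hQ) k)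

omit [FiniteDimensional ℂ Xv] in
-- Termwise, $\max(\kappa_j-k+1,0)-\max(\kappa_j-k,0)$ is $1$ if $\kappa_j\ge k$ and $0$ otherwise.
theorem nu_eq {A Q : Xv →L[ℂ] Xv} {m : ℕ} {κ : Fin m → ℤ}
    (h : ∀ k : ℕ, defectDim A Q k = ∑ j, (κ j - k).toNat) {k : ℕ} (hk : 1 ≤ k) :
    nu A Q k = ((Finset.univ.filter fun j => (k : ℤ) ≤ κ j).card : ℤ) := by
  rw [nu, h, h, Finset.card_filter]
  push_cast
  rw [← Finset.sum_sub_distrib]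
  refine Finset.sum_congr rfl fun j _ => ?_
  have : ((k - 1 : ℕ) : ℤ) = k - 1 := by omega
  split_ifs with hj <;> omega

end Count

/-! ### Conjugate partitions. -/

section Conjugate

theorem card_filter_of_listsPositive {m q : ℕ} {κ : Fin m → ℤ} {ω : Fin q → ℤ}
    (h : ListsPositive κ ω) {k : ℕ} (hk : 1 ≤ k) :
    (Finset.univ.filter fun j => (k : ℤ) ≤ κ j).card =
      (Finset.univ.filter fun j => (k : ℤ) ≤ ω j).card := by
  have h1 := congrArg (Multiset.countP fun n : ℤ => (k : ℤ) ≤ n) h.2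
  rw [Multiset.countP_filter, Multiset.countP_map, Multiset.countP_map] at h1
  simp only [Finset.card_def, Finset.filter_val]
  rw [h1]
  congr 1
  refine Multiset.filter_congr fun j _ => ?_
  constructor
  · intro h; exact ⟨h, by omega⟩
  · exact fun h => h.1

theorem pos_of_listsPositive {m q : ℕ} {κ : Fin m → ℤ} {ω : Fin q → ℤ}
    (h : ListsPositive κ ω) (j : Fin q) : 0 < ω j := by
  have : ω j ∈ (Finset.univ.val.map ω : Multiset ℤ) := Multiset.mem_map_of_mem ω (by simp)
  rw [h.2] at this
  exact (Multiset.mem_filter.1 this).2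

/-- Monotonicity makes $\{i:\omega_i\ge k\}$ an initial segment, so its size decides membership. The
shift by one is due to indexing from $0$. -/
theorem succ_le_card_filter_iff {q : ℕ} {ω : Fin q → ℤ} (h : Antitone ω) (k : ℤ) (j : Fin q) :
    (j : ℕ) + 1 ≤ (Finset.univ.filter fun i => k ≤ ω i).card ↔ k ≤ ω j := by
  constructor
  · intro hj
    by_contra hcon
    have h1 : (Finset.univ.filter fun i => k ≤ ω i) ⊆ Finset.Iio j := fun i hi => by
      simp only [Finset.mem_filter, Finset.mem_univ, true_and] at hi
      rw [Finset.mem_Iio]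
      by_contra hij
      exact hcon (hi.trans (h (not_lt.1 hij)))
    have h2 := Finset.card_le_card h1
    rw [Fin.card_Iio] at h2
    omega
  · intro hj
    have h1 : Finset.Iic j ⊆ (Finset.univ.filter fun i => k ≤ ω i) := fun i hi => by
      simp only [Finset.mem_filter, Finset.mem_univ, true_and]
      exact hj.trans (h (Finset.mem_Iic.1 hi))
    have h2 := Finset.card_le_card h1
    rwa [Fin.card_Iic] at h2

end Conjugate

open Polynomial

/-! ### Wiener–Hopf factorization of rational matrix functions. -/

section MatrixFactorization

variable {n : Type*} [Fintype n] [DecidableEq n]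

/-- The entries of the matrix function are analytic on the closed unit disc. -/
def IsAnalyticMatrix (M : ℂ → Matrix n n ℂ) : Prop :=
  ∀ i j, AnalyticOnNhd ℂ (fun z => M z i j) (closedBall 0 1)

/-- The matrix function is analytic and invertible on the closed unit disc. -/
def IsPlusMatrix (M : ℂ → Matrix n n ℂ) : Prop :=
  IsAnalyticMatrix M ∧ ∀ z ∈ closedBall (0 : ℂ) 1, (M z).det ≠ 0

/-- The matrix function has a right Wiener-Hopf factorization with respect to the unit circle. -/
def IsFactorable (M : ℂ → Matrix n n ℂ) : Prop :=
  ∃ (κ : n → ℤ) (Wm Wp : ℂ → Matrix n n ℂ), IsPlusMatrix Wm ∧ IsPlusMatrix Wp ∧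
    ∀ z : ℂ, ‖z‖ = 1 → M z = Wm (1 / z) * Matrix.diagonal (fun j => z ^ κ j) * Wp z

theorem IsAnalyticMatrix.det {M : ℂ → Matrix n n ℂ} (hM : IsAnalyticMatrix M) :
    AnalyticOnNhd ℂ (fun z => (M z).det) (closedBall 0 1) := by
  simp only [Matrix.det_apply']
  intro z hz
  refine Finset.analyticAt_fun_sum _ fun σ _ => ?_
  have h : AnalyticAt ℂ (fun z => ∏ i, M z (σ i) i) z :=
    Finset.analyticAt_fun_prod _ fun i _ => hM _ _ z hz
  exact analyticAt_const.mul h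

theorem IsAnalyticMatrix.adjugate {M : ℂ → Matrix n n ℂ} (hM : IsAnalyticMatrix M) :
    IsAnalyticMatrix (fun z => (M z).adjugate) := by
  intro i j
  simp only [Matrix.adjugate_apply]
  apply IsAnalyticMatrix.det
  intro a b
  simp only [Matrix.updateRow_apply]
  split_ifs
  · exact analyticOnNhd_const
  · exact hM a b

theorem IsPlusMatrix.inv {M : ℂ → Matrix n n ℂ} (hM : IsPlusMatrix M) :
    IsAnalyticMatrix (fun z => (M z)⁻¹) := by
  intro i j z hz
  simp only [Matrix.inv_def, Matrix.smul_apply, Ring.inverse_eq_inv', smul_eq_mul]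
  exact ((hM.1.det z hz).inv (hM.2 z hz)).mul (hM.1.adjugate i j z hz)

omit [DecidableEq n] in
theorem IsAnalyticMatrix.mul {M N : ℂ → Matrix n n ℂ} (hM : IsAnalyticMatrix M)
    (hN : IsAnalyticMatrix N) : IsAnalyticMatrix (fun z => M z * N z) := by
  intro i j z hz
  simp only [Matrix.mul_apply]
  exact Finset.analyticAt_fun_sum _ fun k _ => (hM i k z hz).mul (hN k j z hz)

theorem IsPlusMatrix.mul {M N : ℂ → Matrix n n ℂ} (hM : IsPlusMatrix M)
    (hN : IsPlusMatrix N) : IsPlusMatrix (fun z => M z * N z) :=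
  ⟨hM.1.mul hN.1, fun z hz => by
    rw [Matrix.det_mul]
    exact mul_ne_zero (hM.2 z hz) (hN.2 z hz)⟩

theorem isPlusMatrix_const {S : Matrix n n ℂ} (hS : S.det ≠ 0) : IsPlusMatrix fun _ => S :=
  ⟨fun _ _ => analyticOnNhd_const, fun _ _ => hS⟩

theorem isPlusMatrix_diagonal {d : ℂ → n → ℂ}
    (hd : ∀ i, AnalyticOnNhd ℂ (fun z => d z i) (closedBall 0 1))
    (hd0 : ∀ z ∈ closedBall (0 : ℂ) 1, ∀ i, d z i ≠ 0) :
    IsPlusMatrix fun z => Matrix.diagonal (d z) := by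
  refine ⟨fun i j => ?_, fun z hz => ?_⟩
  · simp only [Matrix.diagonal_apply]
    split_ifs
    · exact hd i
    · exact analyticOnNhd_const
  · rw [Matrix.det_diagonal]
    exact Finset.prod_ne_zero_iff.2 fun i _ => hd0 z hz i

theorem IsFactorable.congr {M N : ℂ → Matrix n n ℂ} (hM : IsFactorable M)
    (h : ∀ z : ℂ, ‖z‖ = 1 → N z = M z) : IsFactorable N := by
  obtain ⟨κ, Wm, Wp, h1, h2, h3⟩ := hM
  exact ⟨κ, Wm, Wp, h1, h2, fun z hz => (h z hz).trans (h3 z hz)⟩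

theorem IsPlusMatrix.isFactorable {M : ℂ → Matrix n n ℂ} (hM : IsPlusMatrix M) :
    IsFactorable M :=
  ⟨0, fun _ => 1, M, isPlusMatrix_const (by simp), hM, fun z _ => by simp⟩

theorem IsFactorable.minus_mul {M N : ℂ → Matrix n n ℂ} (hM : IsFactorable M)
    (hN : IsPlusMatrix N) : IsFactorable (fun z => N (1 / z) * M z) := by
  obtain ⟨κ, Wm, Wp, h1, h2, h3⟩ := hM
  refine ⟨κ, fun z => N z * Wm z, Wp, hN.mul h1, h2, fun z hz => ?_⟩
  beta_reduce
  rw [h3 z hz]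
  simp only [Matrix.mul_assoc]

theorem IsFactorable.mul_plus {M N : ℂ → Matrix n n ℂ} (hM : IsFactorable M)
    (hN : IsPlusMatrix N) : IsFactorable (fun z => M z * N z) := by
  obtain ⟨κ, Wm, Wp, h1, h2, h3⟩ := hM
  refine ⟨κ, Wm, fun z => Wp z * N z, h1, h2.mul hN, fun z hz => ?_⟩
  beta_reduce
  rw [h3 z hz]
  simp only [Matrix.mul_assoc]

theorem IsFactorable.plus_smul {M : ℂ → Matrix n n ℂ} (hM : IsFactorable M) {p : ℂ → ℂ}
    (hp : AnalyticOnNhd ℂ p (closedBall 0 1)) (hp0 : ∀ z ∈ closedBall (0 : ℂ) 1, p z ≠ 0) :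
    IsFactorable (fun z => p z • M z) :=
  (hM.mul_plus (isPlusMatrix_diagonal (d := fun z _ => p z) (fun _ => hp)
    fun z hz _ => hp0 z hz)).congr fun z _ => by
      ext i j
      simp [Matrix.mul_diagonal, mul_comm]

theorem IsFactorable.minus_smul {M : ℂ → Matrix n n ℂ} (hM : IsFactorable M) {p : ℂ → ℂ}
    (hp : AnalyticOnNhd ℂ p (closedBall 0 1)) (hp0 : ∀ z ∈ closedBall (0 : ℂ) 1, p z ≠ 0) :
    IsFactorable (fun z => p (1 / z) • M z) :=
  (hM.minus_mul (isPlusMatrix_diagonal (d := fun z _ => p z) (fun _ => hp)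
    fun z hz _ => hp0 z hz)).congr fun z _ => by
      ext i j
      simp [Matrix.diagonal_mul]

theorem IsFactorable.inv_smul {M : ℂ → Matrix n n ℂ} (hM : IsFactorable M) :
    IsFactorable (fun z => z⁻¹ • M z) := by
  obtain ⟨κ, Wm, Wp, h1, h2, h3⟩ := hM
  refine ⟨fun j => κ j - 1, Wm, Wp, h1, h2, fun z hz => ?_⟩
  have hz0 : z ≠ 0 := by rintro rfl; simp at hz
  have h4 : (Matrix.diagonal fun j => z ^ (κ j - 1)) =
      z⁻¹ • Matrix.diagonal fun j => z ^ κ j := by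
    rw [← Matrix.diagonal_smul]
    congr 1
    ext j
    rw [Pi.smul_apply, zpow_sub_one₀ hz0, smul_eq_mul, mul_comm]
  beta_reduce
  rw [h3 z hz, h4, Matrix.mul_smul, Matrix.smul_mul]

theorem analyticOnNhd_one_sub_mul (α : ℂ) (s : Set ℂ) :
    AnalyticOnNhd ℂ (fun u => 1 - α * u) s := fun _ _ =>
  analyticAt_const.sub (analyticAt_const.mul analyticAt_id)

theorem one_sub_mul_ne_zero {α : ℂ} (hα : ‖α‖ < 1) {u : ℂ} (hu : u ∈ closedBall (0 : ℂ) 1) :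
    1 - α * u ≠ 0 := by
  intro h
  have h1 : α * u = 1 := (sub_eq_zero.1 h).symm
  have h2 := congrArg norm h1
  rw [norm_mul, norm_one] at h2
  have h3 : ‖u‖ ≤ 1 := by simpa using hu
  nlinarith [norm_nonneg α, norm_nonneg u]

/-- A pole outside the disc gives a plus factor. For one inside,
$(z-\alpha)^{-1}=z^{-1}(1-\alpha/z)^{-1}$ is a shift of all indices times a minus factor. -/
theorem IsFactorable.sub_inv_smul {M : ℂ → Matrix n n ℂ} (hM : IsFactorable M) {α : ℂ}
    (hα : ‖α‖ ≠ 1) : IsFactorable (fun z => (z - α)⁻¹ • M z) := by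
  rcases lt_or_gt_of_ne hα with h | h
  · refine (hM.inv_smul.minus_smul (p := fun u => (1 - α * u)⁻¹)
      (fun u hu => (analyticOnNhd_one_sub_mul α _ u hu).inv (one_sub_mul_ne_zero h hu))
      fun u hu => inv_ne_zero (one_sub_mul_ne_zero h hu)).congr fun z hz => ?_
    have hz0 : z ≠ 0 := by rintro rfl; simp at hz
    rw [smul_smul, ← mul_inv]
    congr 2
    field_simp
  · have h0 : ∀ z ∈ closedBall (0 : ℂ) 1, z - α ≠ 0 := fun z hz h1 => by
      have h3 : ‖z‖ ≤ 1 := by simpa using hz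
      rw [sub_eq_zero.1 h1] at h3
      linarith
    exact hM.plus_smul (p := fun z => (z - α)⁻¹)
      (fun z hz => (analyticAt_id.sub analyticAt_const).inv (h0 z hz))
      fun z hz => inv_ne_zero (h0 z hz)

theorem IsFactorable.eval_inv_smul {M : ℂ → Matrix n n ℂ} (hM : IsFactorable M) {s : ℂ[X]}
    (hs : ∀ z : ℂ, ‖z‖ = 1 → s.eval z ≠ 0) : IsFactorable (fun z => (s.eval z)⁻¹ • M z) := by
  have hs0 : s ≠ 0 := by
    rintro rfl
    exact hs 1 (by simp) (by simp)
  have h1 : ∀ t : Multiset ℂ, (∀ α ∈ t, ‖α‖ ≠ 1) →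
      IsFactorable (fun z => ((t.map fun α => z - α).prod)⁻¹ • M z) := by
    intro t
    induction t using Multiset.induction_on with
    | empty => intro _; simpa using hM
    | cons α t ih =>
      intro ht
      refine ((ih fun β hβ => ht β (Multiset.mem_cons_of_mem hβ)).sub_inv_smul
        (ht α (Multiset.mem_cons_self α t))).congr fun z _ => ?_
      rw [Multiset.map_cons, Multiset.prod_cons, mul_inv, smul_smul]
  have h2 : ∀ α ∈ s.roots, ‖α‖ ≠ 1 := fun α hα h => hs α h ((mem_roots hs0).1 hα)
  refine ((h1 s.roots h2).plus_smul (p := fun _ => s.leadingCoeff⁻¹) analyticOnNhd_const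
    fun z _ => inv_ne_zero (leadingCoeff_ne_zero.2 hs0)).congr fun z _ => ?_
  have h3 := congrArg (eval z) (IsAlgClosed.splits s).eq_prod_roots
  rw [eval_mul, eval_C, eval_multiset_prod, Multiset.map_map] at h3
  simp only [Function.comp_def, eval_sub, eval_X, eval_C] at h3
  rw [h3, smul_smul, mul_inv]

theorem analyticOnNhd_dslope {f : ℂ → ℂ} (hf : AnalyticOnNhd ℂ f (closedBall 0 1)) :
    AnalyticOnNhd ℂ (dslope f 0) (closedBall 0 1) := by
  have ho : IsOpen {z | AnalyticAt ℂ f z} := isOpen_analyticAt ℂ f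
  have h0 : {z | AnalyticAt ℂ f z} ∈ nhds (0 : ℂ) := ho.mem_nhds (hf 0 (by simp))
  have hd : DifferentiableOn ℂ (dslope f 0) {z | AnalyticAt ℂ f z} := by
    rw [Complex.differentiableOn_dslope h0]
    exact fun z hz => AnalyticAt.differentiableWithinAt hz
  exact fun z hz => hd.analyticAt (ho.mem_nhds (hf z hz))

theorem eval_eq_of_eqOn_ne {f g : ℂ → ℂ} (hf : ContinuousAt f 0) (hg : ContinuousAt g 0)
    (h : ∀ u, u ≠ 0 → f u = g u) : f 0 = g 0 := by
  have h1 : Filter.Tendsto f (nhdsWithin 0 {0}ᶜ) (nhds (f 0)) :=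
    hf.tendsto.mono_left nhdsWithin_le_nhds
  have h2 : Filter.Tendsto g (nhdsWithin 0 {0}ᶜ) (nhds (g 0)) :=
    hg.tendsto.mono_left nhdsWithin_le_nhds
  refine tendsto_nhds_unique h1 (h2.congr' ?_)
  filter_upwards [self_mem_nhdsWithin] with u hu
  exact (h u hu).symm

/-- If the row `i` of `N(0)` vanishes off the column `j`, the diagonal factor `z` at `i` moves
through `N(1/z)` to the diagonal position `j`. -/
theorem exists_isPlusMatrix_swap {N : ℂ → Matrix n n ℂ} (hN : IsPlusMatrix N) {i j : n}
    (h0 : ∀ b, b ≠ j → N 0 i b = 0) :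
    ∃ N' : ℂ → Matrix n n ℂ, IsPlusMatrix N' ∧ ∀ u : ℂ, u ≠ 0 →
      N' u = Matrix.diagonal (Function.update 1 i u⁻¹) * N u *
        Matrix.diagonal (Function.update 1 j u) := by
  -- Row $i$ is divided by $u$, legitimately at $0$ because those entries vanish there; column $j$
  -- is multiplied by $u$; at the crossing the two cancel.
  let N' : ℂ → Matrix n n ℂ := fun u => Matrix.of fun a b =>
    if a = i then (if b = j then N u i j else dslope (fun u => N u i b) 0 u)
    else (if b = j then u * N u a j else N u a b)
  have hN'a : IsAnalyticMatrix N' := by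
    intro a b
    simp only [N', Matrix.of_apply]
    split_ifs
    · exact hN.1 i j
    · exact analyticOnNhd_dslope (hN.1 i b)
    · exact analyticOnNhd_id.mul (hN.1 a j)
    · exact hN.1 a b
  have hN' : ∀ u : ℂ, u ≠ 0 → N' u = Matrix.diagonal (Function.update 1 i u⁻¹) * N u *
        Matrix.diagonal (Function.update 1 j u) := fun u hu => by
    ext a b
    rw [Matrix.mul_diagonal, Matrix.diagonal_mul]
    simp only [N', Matrix.of_apply, Function.update_apply, Pi.one_apply]
    split_ifs with ha hb hb
    · rw [ha, hb]; field_simp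
    · rw [dslope_of_ne _ hu, slope_def_field, h0 b hb, ha]
      field_simp
      ring
    · rw [hb]; ring
    · ring
  refine ⟨N', ⟨hN'a, ?_⟩, hN'⟩
  -- The factors $u^{-1}$ and $u$ cancel in the determinant, and continuity carries the equality to
  -- $u=0$.
  have hdet : ∀ u, u ≠ 0 → (N' u).det = (N u).det := fun u hu => by
    have h1 : ∀ (i : n) (c : ℂ), (Matrix.diagonal (Function.update 1 i c)).det = c := fun i c => by
      rw [Matrix.det_diagonal, Finset.prod_update_of_mem (Finset.mem_univ i)]
      simp
    rw [hN' u hu, Matrix.det_mul, Matrix.det_mul, h1, h1]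
    field_simp
  intro z hz
  by_cases hz0 : z = 0
  · subst hz0
    rw [eval_eq_of_eqOn_ne (hN'a.det 0 hz).continuousAt (hN.1.det 0 hz).continuousAt hdet]
    exact hN.2 0 hz
  · rw [hdet z hz0]
    exact hN.2 z hz

theorem det_updateRow_one (j : n) (c : n → ℂ) : (Matrix.updateRow 1 j c).det = c j := by
  have h := Matrix.cramer_transpose_apply (1 : Matrix n n ℂ) c j
  rw [Matrix.transpose_one, Matrix.cramer_one] at h
  exact h.symm

/-- A constant column operation $U$ clears row $i$ of $N(0)$ except for a pivot column $j$, after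
which the factor $z$ passes from $i$ to $j$ and raises $\kappa_j$ by one. The price is
$P=D^{-1}U^{-1}D$ with $D=\mathrm{diag}(z^{\kappa_b})$, whose nonconstant entries are multiples of
$z^{\kappa_b-\kappa_j}$. Choosing the pivot with least $\kappa_j$ makes $P$ a plus factor. -/
theorem IsPlusMatrix.isFactorable_shift {N : ℂ → Matrix n n ℂ} (hN : IsPlusMatrix N) (i : n)
    (κ : n → ℤ) :
    IsFactorable (fun z => Matrix.diagonal (Function.update 1 i z) *
      (N (1 / z) * Matrix.diagonal fun j => z ^ κ j)) := by
  let r : n → ℂ := N 0 i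
  have hr : ∃ j, r j ≠ 0 := by
    by_contra! h
    exact hN.2 0 (by simp) (Matrix.det_eq_zero_of_row_eq_zero i h)
  obtain ⟨j, hj, hmin⟩ := (Finset.univ.filter fun j => r j ≠ 0).exists_min_image κ
    (by simpa [Finset.Nonempty] using hr)
  simp only [Finset.mem_filter, Finset.mem_univ, true_and] at hj hmin
  let U : Matrix n n ℂ := Matrix.updateRow 1 j fun b => if b = j then 1 else -(r b / r j)
  -- The truncated exponent is exact wherever $r_b\ne0$, by the choice of $j$; elsewhere the entry
  -- is $0$ anyway.
  let P : ℂ → Matrix n n ℂ := fun z =>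
    Matrix.updateRow 1 j fun b => z ^ (κ b - κ j).toNat * (r b / r j)
  have hU : U.det ≠ 0 := by simp [U, det_updateRow_one]
  have hP : IsPlusMatrix P := by
    refine ⟨fun a b => ?_, fun z _ => ?_⟩
    · simp only [P, Matrix.updateRow_apply]
      split_ifs
      · exact (analyticOnNhd_id.pow _).mul analyticOnNhd_const
      · exact analyticOnNhd_const
    · simp only [P, det_updateRow_one]
      simp [hj]
  have hrow : ∀ b, b ≠ j → (N 0 * U) i b = 0 := fun b hb => by
    have h1 : ∀ c, N 0 i c * U c b = (if c = b then r b else 0) + (if c = j then -r b else 0) := by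
      intro c
      simp only [U, Matrix.updateRow_apply, Matrix.one_apply, if_neg hb]
      by_cases hc : c = j
      · subst hc
        rw [if_pos rfl, if_neg (Ne.symm hb), if_pos rfl]
        change r c * _ = _
        field_simp
        ring
      · rw [if_neg hc, if_neg hc]
        by_cases hcb : c = b
        · subst hcb; simp [r]
        · simp [hcb]
    rw [Matrix.mul_apply, Finset.sum_congr rfl fun c _ => h1 c, Finset.sum_add_distrib]
    simp
  obtain ⟨N', hN', hN'u⟩ := exists_isPlusMatrix_swap (hN.mul (isPlusMatrix_const hU)) hrow
  refine ⟨Function.update κ j (κ j + 1), N', P, hN', hP, fun z hz => ?_⟩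
  have hz0 : z ≠ 0 := by rintro rfl; simp at hz
  have hUP : (Matrix.diagonal fun j => z ^ κ j) = U * (Matrix.diagonal fun j => z ^ κ j) * P z := by
    have hP' : P z = Matrix.updateRow 1 j fun b => z ^ (κ b - κ j) * (r b / r j) := by
      simp only [P]
      congr 1
      ext b
      by_cases hb : r b = 0
      · simp [hb]
      · rw [← zpow_natCast, Int.toNat_of_nonneg (sub_nonneg.2 (hmin b hb))]
    rw [hP']
    ext a b
    have h1 : ∀ c, (U * Matrix.diagonal fun j => z ^ κ j) a c *
        Matrix.updateRow 1 j (fun b => z ^ (κ b - κ j) * (r b / r j)) c b =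
        (if c = b then (if b = j then 0 else U a b * z ^ κ b) else 0) +
        (if c = j then U a j * z ^ κ b * (r b / r j) else 0) := by
      intro c
      rw [Matrix.mul_diagonal, Matrix.updateRow_apply, Matrix.one_apply]
      by_cases hc : c = j
      · subst hc
        have h2 : (if c = b then (if b = c then (0 : ℂ) else U a b * z ^ κ b) else 0) = 0 := by
          by_cases h : c = b
          · simp [h]
          · simp [h]
        rw [h2, if_pos rfl, if_pos rfl, zpow_sub₀ hz0]
        field_simp
        ring
      · rw [if_neg hc, if_neg hc]
        by_cases hcb : c = b
        · subst hcb; simp [hc]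
        · simp [hcb]
    rw [Matrix.mul_apply, Finset.sum_congr rfl fun c _ => h1 c, Finset.sum_add_distrib,
      Finset.sum_ite_eq' Finset.univ b, Finset.sum_ite_eq' Finset.univ j]
    simp only [Finset.mem_univ, if_true, U, Matrix.updateRow_apply, Matrix.one_apply,
      Matrix.diagonal_apply]
    by_cases ha : a = j
    · subst ha
      by_cases hb : b = a
      · subst hb
        simp [hj]
      · simp only [if_true, if_neg hb, if_neg (Ne.symm hb)]
        ring
    · simp only [if_neg ha]
      by_cases hb : b = j
      · subst hb; simp [ha]
      · by_cases hab : a = b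
        · subst hab; simp [ha]
        · simp [hab, hb]
  have hdiag : (Matrix.diagonal fun a => z ^ Function.update κ j (κ j + 1) a) =
      Matrix.diagonal (Function.update 1 j z) * Matrix.diagonal fun a => z ^ κ a := by
    rw [Matrix.diagonal_mul_diagonal]
    congr 1
    ext a
    by_cases ha : a = j
    · subst ha; simp [zpow_add_one₀ hz0, mul_comm]
    · simp [ha]
  have hcancel : Matrix.diagonal (Function.update 1 j (1 / z)) *
      Matrix.diagonal (Function.update 1 j z) = (1 : Matrix n n ℂ) := by
    rw [Matrix.diagonal_mul_diagonal, ← Matrix.diagonal_one]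
    congr 1
    ext a
    by_cases ha : a = j
    · subst ha; simp [hz0]
    · simp [ha]
  have hinv : (1 / z)⁻¹ = z := by simp
  rw [hN'u _ (one_div_ne_zero hz0), hdiag, hinv]
  beta_reduce
  conv_lhs => rw [hUP]
  simp only [Matrix.mul_assoc]
  rw [← Matrix.mul_assoc (Matrix.diagonal (Function.update 1 j (1 / z))), hcancel, Matrix.one_mul]

theorem IsFactorable.shift_mul {M : ℂ → Matrix n n ℂ} (hM : IsFactorable M) (i : n) :
    IsFactorable (fun z => Matrix.diagonal (Function.update 1 i z) * M z) := by
  obtain ⟨κ, Wm, Wp, h1, h2, h3⟩ := hM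
  refine ((h1.isFactorable_shift i κ).mul_plus h2).congr fun z hz => ?_
  rw [h3 z hz]
  simp only [Matrix.mul_assoc]

/-- Here $z-\alpha=(1-\alpha/z)\,z$: the first factor joins the minus side and the second is the
shift already treated. -/
theorem IsFactorable.sub_mul {M : ℂ → Matrix n n ℂ} (hM : IsFactorable M) (i : n) {α : ℂ}
    (hα : ‖α‖ < 1) :
    IsFactorable (fun z => Matrix.diagonal (Function.update 1 i (z - α)) * M z) := by
  have hd : IsPlusMatrix fun u => Matrix.diagonal (Function.update (1 : n → ℂ) i (1 - α * u)) := by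
    apply isPlusMatrix_diagonal
    · intro a
      by_cases ha : a = i
      · subst ha
        simp only [Function.update_self]
        exact analyticOnNhd_one_sub_mul α _
      · simp only [Function.update_of_ne ha]
        exact analyticOnNhd_const
    · intro u hu a
      by_cases ha : a = i
      · subst ha
        simp only [Function.update_self]
        exact one_sub_mul_ne_zero hα hu
      · simp [ha]
  refine ((hM.shift_mul i).minus_mul hd).congr fun z hz => ?_
  have hz0 : z ≠ 0 := by rintro rfl; simp at hz
  rw [← Matrix.mul_assoc, Matrix.diagonal_mul_diagonal]
  congr 2
  ext a
  by_cases ha : a = i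
  · subst ha
    simp only [Function.update_self]
    field_simp
  · simp [ha]

theorem analyticOnNhd_eval (p : ℂ[X]) (s : Set ℂ) : AnalyticOnNhd ℂ (fun z => p.eval z) s :=
  fun z _ => by
    rw [Complex.analyticAt_iff_eventually_differentiableAt]
    exact Filter.Eventually.of_forall fun y => p.differentiable.differentiableAt

/-- Induction on $\deg\det P$. Without zeros of the determinant in the closed disc, $P$ is itself a
plus factor. Otherwise a linear factor $z-\alpha$ splits off one row, after a constant row
operation, and the degree drops by one. -/
theorem isFactorable_polynomial (P : Matrix n n ℂ[X])
    (hP : ∀ z : ℂ, ‖z‖ = 1 → P.det.eval z ≠ 0) : IsFactorable (fun z => P.map (eval z)) := by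
  have hdet : ∀ (P : Matrix n n ℂ[X]) (z : ℂ), (P.map (eval z)).det = P.det.eval z := fun P z => by
    have := RingHom.map_det (evalRingHom z) P
    simpa [RingHom.mapMatrix_apply] using this.symm
  induction hd : P.det.natDegree generalizing P with
  | zero =>
    apply IsPlusMatrix.isFactorable
    refine ⟨fun i j => analyticOnNhd_eval (P i j) _, fun z _ => ?_⟩
    rw [hdet]
    rw [natDegree_eq_zero] at hd
    obtain ⟨c, hc⟩ := hd
    have := hP 1 (by simp)
    rw [← hc] at this ⊢
    simpa using this
  | succ d ih =>
    by_cases hroot : ∃ α : ℂ, ‖α‖ ≤ 1 ∧ P.det.eval α = 0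
    · obtain ⟨α, hα, hα0⟩ := hroot
      have hα1 : ‖α‖ < 1 := lt_of_le_of_ne hα fun h => hP α h hα0
      rw [← hdet] at hα0
      -- The combination of rows with coefficients $c$ vanishes at $\alpha$, so it is divisible by
      -- $X-\alpha$. Placing it in a row $i$ with $c_i\ne0$ keeps the row operation invertible.
      obtain ⟨c, hc, hc0⟩ := Matrix.exists_vecMul_eq_zero_iff.2 hα0
      obtain ⟨i, hi⟩ := Function.ne_iff.1 hc
      let S : Matrix n n ℂ := Matrix.updateRow 1 i c
      have hS : S.det ≠ 0 := by
        simp only [S, det_updateRow_one]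
        exact hi
      let row : n → ℂ[X] := fun b => ∑ a, C (c a) * P a b
      have hrow : ∀ b, (X - C α) * (row b /ₘ (X - C α)) = row b := fun b => by
        rw [mul_divByMonic_eq_iff_isRoot]
        have := congrFun hc0 b
        simpa [row, IsRoot, eval_finsetSum, Matrix.vecMul, dotProduct] using this
      let P' : Matrix n n ℂ[X] := P.updateRow i fun b => row b /ₘ (X - C α)
      have hSP : S.map C * P = Matrix.diagonal (Function.update 1 i (X - C α)) * P' := by
        ext1 a b
        rw [Matrix.diagonal_mul, Matrix.mul_apply]
        by_cases ha : a = i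
        · subst ha
          simp only [S, P', Matrix.map_apply, Matrix.updateRow_self, Function.update_self, hrow]
          rfl
        · simp [S, P', Matrix.one_apply, ha]
      have hdetSP : C S.det * P.det = (X - C α) * P'.det := by
        have h1 := congrArg Matrix.det hSP
        rw [Matrix.det_mul, Matrix.det_mul, Matrix.det_diagonal,
          Finset.prod_update_of_mem (Finset.mem_univ i)] at h1
        have h2 : (S.map C).det = C S.det := by
          have := RingHom.map_det (C : ℂ →+* ℂ[X]) S
          simpa [RingHom.mapMatrix_apply] using this.symm
        rw [h2] at h1
        simpa using h1
      have hP'0 : ∀ z : ℂ, ‖z‖ = 1 → P'.det.eval z ≠ 0 := fun z hz h => by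
        have h1 := congrArg (eval z) hdetSP
        rw [eval_mul, eval_mul, h, mul_zero, eval_C] at h1
        exact mul_ne_zero hS (hP z hz) h1
      have hP'd : P'.det.natDegree = d := by
        have h1 := congrArg natDegree hdetSP
        have h2 : P'.det ≠ 0 := fun h => hP'0 1 (by simp) (by simp [h])
        rw [natDegree_C_mul hS, hd, natDegree_mul (X_sub_C_ne_zero α) h2, natDegree_X_sub_C] at h1
        omega
      have hSi : (S⁻¹).det ≠ 0 := by
        rw [Matrix.det_nonsing_inv, Ring.inverse_eq_inv']
        exact inv_ne_zero hS
      refine (((ih P' hP'0 hP'd).sub_mul i hα1).minus_mul (isPlusMatrix_const hSi)).congr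
        fun z _ => ?_
      have h1 := congrArg (fun M : Matrix n n ℂ[X] => M.map (evalRingHom z)) hSP
      simp only [Matrix.map_mul] at h1
      have h2 : (S.map C).map (evalRingHom z) = S := by
        ext a b
        simp
      have h3 : (Matrix.diagonal (Function.update 1 i (X - C α))).map (evalRingHom z) =
          Matrix.diagonal (Function.update 1 i (z - α)) := by
        rw [Matrix.diagonal_map (map_zero _)]
        congr 1
        ext a
        by_cases ha : a = i
        · subst ha; simp
        · simp [ha]
      rw [h2, h3] at h1
      have h4 : ∀ M : Matrix n n ℂ[X], M.map (evalRingHom z) = M.map (eval z) := fun _ => rfl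
      rw [h4, h4] at h1
      rw [← h1, ← Matrix.mul_assoc, Matrix.nonsing_inv_mul _ (isUnit_iff_ne_zero.2 hS),
        Matrix.one_mul]
    · push Not at hroot
      apply IsPlusMatrix.isFactorable
      refine ⟨fun i j => analyticOnNhd_eval (P i j) _, fun z hz => ?_⟩
      rw [hdet]
      exact hroot z (by simpa using hz)

end MatrixFactorization

/-! ### Existence of the Wiener–Hopf indices. -/

section Existence

variable {E X : Type*}
  [NormedAddCommGroup E] [InnerProductSpace ℂ E] [FiniteDimensional ℂ E]
  [NormedAddCommGroup X] [InnerProductSpace ℂ X] [FiniteDimensional ℂ X]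

/-- The operator with a given matrix. -/
def ofMatrix {m : ℕ} (b : Module.Basis (Fin m) ℂ E) (M : Matrix (Fin m) (Fin m) ℂ) : E →L[ℂ] E :=
  LinearMap.toContinuousLinearMap (Matrix.toLin b b M)

theorem ofMatrix_mul {m : ℕ} (b : Module.Basis (Fin m) ℂ E) (M N : Matrix (Fin m) (Fin m) ℂ) :
    ofMatrix b (M * N) = ofMatrix b M * ofMatrix b N := by
  ext x
  simp [ofMatrix, Matrix.toLin_mul b b b]

theorem ofMatrix_one {m : ℕ} (b : Module.Basis (Fin m) ℂ E) : ofMatrix b 1 = 1 := by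
  ext x
  simp [ofMatrix]

theorem ofMatrix_toMatrix {m : ℕ} (b : Module.Basis (Fin m) ℂ E) (T : E →L[ℂ] E) :
    ofMatrix b (LinearMap.toMatrix b b T.toLinearMap) = T := by
  ext x
  simp [ofMatrix]

theorem IsAnalyticMatrix.ofMatrix {m : ℕ} (b : Module.Basis (Fin m) ℂ E)
    {M : ℂ → Matrix (Fin m) (Fin m) ℂ} (hM : IsAnalyticMatrix M) :
    AnalyticOnNhd ℂ (fun z => ofMatrix b (M z)) (closedBall 0 1) := by
  let ℓ : (Fin m → Fin m → ℂ) →L[ℂ] (E →L[ℂ] E) := LinearMap.toContinuousLinearMap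
    (LinearMap.toContinuousLinearMap.toLinearMap ∘ₗ (Matrix.toLin b b).toLinearMap ∘ₗ
      (Matrix.ofLinearEquiv ℂ).toLinearMap)
  intro z hz
  have h : AnalyticAt ℂ (fun z => (fun i j => M z i j : Fin m → Fin m → ℂ)) z :=
    analyticAt_pi_iff.2 fun i => analyticAt_pi_iff.2 fun j => hM i j z hz
  exact (ℓ.analyticAt _).fun_comp h

theorem IsPlusMatrix.ofMatrix {m : ℕ} (b : Module.Basis (Fin m) ℂ E)
    {M : ℂ → Matrix (Fin m) (Fin m) ℂ} (hM : IsPlusMatrix M) :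
    IsPlusFactor fun z => ofMatrix b (M z) := by
  refine ⟨hM.1.ofMatrix b, fun z => WienerHopf.ofMatrix b (M z)⁻¹, hM.inv.ofMatrix b,
    fun z hz => ?_⟩
  have hu : IsUnit (M z).det := isUnit_iff_ne_zero.2 (hM.2 z hz)
  rw [← ofMatrix_mul, ← ofMatrix_mul, Matrix.mul_nonsing_inv _ hu, Matrix.nonsing_inv_mul _ hu,
    ofMatrix_one]
  exact ⟨rfl, rfl⟩

theorem IsFactorable.exists_hasWienerHopfIndices
    (b : Module.Basis (Fin (Module.finrank ℂ E)) ℂ E) {R : ℂ → E →L[ℂ] E}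
    (hR : IsFactorable fun z => LinearMap.toMatrix b b (R z).toLinearMap) :
    ∃ κ, HasWienerHopfIndices R κ := by
  obtain ⟨κ, Wm, Wp, hm, hp, hfac⟩ := hR
  refine ⟨κ, b, fun z => ofMatrix b (Wm (1 / z)), fun z => ofMatrix b (Wp z),
    ⟨fun u => ofMatrix b (Wm u), hm.ofMatrix b, fun z _ => rfl⟩, hp.ofMatrix b, fun z hz => ?_⟩
  rw [← ofMatrix_toMatrix b (R z)]
  beta_reduce at hfac ⊢
  rw [hfac z hz, ofMatrix_mul, ofMatrix_mul]
  rfl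

omit [FiniteDimensional ℂ E] in
/-- A stable transfer function is the quotient of a polynomial matrix and a scalar polynomial
without zeros in the closed disc. -/
theorem Realization.IsStable.exists_polynomial {r : Realization X E} (hr : r.IsStable)
    {m : ℕ} (b : Module.Basis (Fin m) ℂ E) :
    ∃ (ρ : ℂ[X]) (P : Matrix (Fin m) (Fin m) ℂ[X]), ∀ z : ℂ, ‖z‖ ≤ 1 → ρ.eval z ≠ 0 ∧
      P.map (eval z) = ρ.eval z • LinearMap.toMatrix b b (r.transferFunction z).toLinearMap := by
  let e := Module.finBasis ℂ X
  let a := LinearMap.toMatrix e e r.A.toLinearMap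
  let β := LinearMap.toMatrix b e r.B.toLinearMap
  let γ := LinearMap.toMatrix e b r.C.toLinearMap
  let δ := LinearMap.toMatrix b b r.D.toLinearMap
  -- Cramer's rule: $(I-zA)^{-1}$ is the adjugate divided by the determinant, so $\rho=\det(I-zA)$
  -- is a common denominator.
  let M : Matrix (Fin (Module.finrank ℂ X)) (Fin (Module.finrank ℂ X)) ℂ[X] :=
    1 - (Polynomial.X : ℂ[X]) • a.map Polynomial.C
  refine ⟨M.det, M.det • δ.map Polynomial.C +
    (Polynomial.X : ℂ[X]) • (γ.map Polynomial.C * M.adjugate * β.map Polynomial.C),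
    fun z hz => ?_⟩
  have hMz : M.map (evalRingHom z) = 1 - z • a := by
    ext i j
    simp [M, Matrix.one_apply, apply_ite (eval z)]
    exact mul_comm _ _
  have hdet : M.det.eval z = (1 - z • a).det := by
    rw [← hMz]
    exact RingHom.map_det (evalRingHom z) M
  have hadj : M.adjugate.map (evalRingHom z) = (1 - z • a).adjugate := by
    rw [← hMz]
    exact RingHom.map_adjugate (evalRingHom z) M
  have htr : LinearMap.toMatrix e e (1 - z • r.A : X →L[ℂ] X).toLinearMap = 1 - z • a := by
    have : (1 - z • r.A : X →L[ℂ] X).toLinearMap = LinearMap.id - z • r.A.toLinearMap := rfl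
    rw [this, map_sub, map_smul, LinearMap.toMatrix_id]
  have hinv : (1 - z • a) * LinearMap.toMatrix e e (resolventAt r.A z).toLinearMap = 1 := by
    rw [← htr, ← LinearMap.toMatrix_comp e e e, ← LinearMap.toMatrix_id e]
    congr 1
    ext x
    have := hr.isStableOperator.sub_resolventAt hz x
    simpa using this
  have hdet0 : (1 - z • a).det ≠ 0 := fun h => by
    have := congrArg Matrix.det hinv
    rw [Matrix.det_mul, h, zero_mul, Matrix.det_one] at this
    exact zero_ne_one this
  have hres : (1 - z • a).adjugate =
      (1 - z • a).det • LinearMap.toMatrix e e (resolventAt r.A z).toLinearMap := by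
    have := congrArg (fun N => (1 - z • a).adjugate * N) hinv
    simp only [← Matrix.mul_assoc, Matrix.adjugate_mul, Matrix.mul_one, Matrix.smul_mul,
      Matrix.one_mul] at this
    exact this.symm
  have htf : LinearMap.toMatrix b b (r.transferFunction z).toLinearMap =
      δ + z • (γ * LinearMap.toMatrix e e (resolventAt r.A z).toLinearMap * β) := by
    have : (r.transferFunction z).toLinearMap = r.D.toLinearMap +
      z • ((r.C.toLinearMap ∘ₗ (resolventAt r.A z).toLinearMap) ∘ₗ r.B.toLinearMap) := rfl
    rw [this, map_add, map_smul, LinearMap.toMatrix_comp b e b, LinearMap.toMatrix_comp e e b]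
  refine ⟨by rwa [hdet], ?_⟩
  have hC : ∀ {k l : ℕ} (N : Matrix (Fin k) (Fin l) ℂ),
      (N.map Polynomial.C).map (evalRingHom z) = N := by
    intro k l N
    ext i j
    simp
  have h1 : (γ.map Polynomial.C * M.adjugate * β.map Polynomial.C).map (evalRingHom z) =
      γ * (1 - z • a).adjugate * β := by
    rw [Matrix.map_mul, Matrix.map_mul, hC, hC, hadj]
  rw [hres] at h1
  rw [htf, hdet]
  ext i j
  have h2 := congrFun (congrFun h1 i) j
  simp only [Matrix.map_apply, coe_evalRingHom, Matrix.mul_smul, Matrix.smul_mul,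
    Matrix.smul_apply, smul_eq_mul] at h2
  simp only [Matrix.map_apply, Matrix.add_apply, Matrix.smul_apply, smul_eq_mul, eval_add, eval_mul,
    eval_X, eval_C, h2, hdet]
  ring

variable {Xv Xw : Type*} [CompleteSpace E]
  [NormedAddCommGroup Xv] [InnerProductSpace ℂ Xv] [FiniteDimensional ℂ Xv] [CompleteSpace Xv]
  [NormedAddCommGroup Xw] [InnerProductSpace ℂ Xw] [FiniteDimensional ℂ Xw] [CompleteSpace Xw]
  {v : Realization Xv E} {w : Realization Xw E}

/-- With $V=P/\rho$ and $W=S/\sigma$, unitarity on the circle gives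
$W^*=W^{-1}=\sigma\,\mathrm{adj}(S)/\det S$. Hence $R=\frac{\sigma}{\rho\det
S}\,P\,\mathrm{adj}(S)$, where $\sigma/\rho$ is a plus factor and $\det S$ has no zeros on the
circle. -/
theorem exists_hasWienerHopfIndices (hv : v.IsStable) (hvu : v.IsUnitary) (hw : w.IsStable)
    (hwu : w.IsUnitary) {R : ℂ → E →L[ℂ] E} (hR : ∀ z : ℂ, ‖z‖ = 1 →
      R z = v.transferFunction z ∘L paraAdjoint w.transferFunction z) :
    ∃ κ, HasWienerHopfIndices R κ := by
  let b := Module.finBasis ℂ E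
  let m : (E →L[ℂ] E) → Matrix _ _ ℂ := fun T => LinearMap.toMatrix b b T.toLinearMap
  have hmul : ∀ S T : E →L[ℂ] E, m (S * T) = m S * m T := fun S T =>
    LinearMap.toMatrix_comp b b b _ _
  have hone : m 1 = 1 := LinearMap.toMatrix_id b
  obtain ⟨ρ, P, hP⟩ := hv.exists_polynomial b
  obtain ⟨σ, S, hS⟩ := hw.exists_polynomial b
  have hVinv : ∀ z : ℂ, ‖z‖ = 1 →
      m (v.transferFunction z) * m (v.dual.transferFunction (1 / z)) = 1 := fun z hz => by
    rw [← hmul, Realization.transferFunction_mul_dual hv hvu hz, hone]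
  have hWinv : ∀ z : ℂ, ‖z‖ = 1 →
      m (w.transferFunction z) * m (w.dual.transferFunction (1 / z)) = 1 := fun z hz => by
    rw [← hmul, Realization.transferFunction_mul_dual hw hwu hz, hone]
  have hdet : ∀ (N : Matrix (Fin (Module.finrank ℂ E)) (Fin (Module.finrank ℂ E)) ℂ[X]) (z : ℂ),
      N.det.eval z = (N.map (eval z)).det := fun N z => RingHom.map_det (evalRingHom z) N
  have hne : ∀ A B : Matrix (Fin (Module.finrank ℂ E)) (Fin (Module.finrank ℂ E)) ℂ, ∀ c : ℂ,
      c ≠ 0 → A * B = 1 → (c • A).det ≠ 0 := fun A B c hc hAB => by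
    have h1 := congrArg Matrix.det hAB
    rw [Matrix.det_mul, Matrix.det_one] at h1
    rw [Matrix.det_smul]
    exact mul_ne_zero (pow_ne_zero _ hc) (left_ne_zero_of_mul_eq_one h1)
  have hPdet : ∀ z : ℂ, ‖z‖ = 1 → P.det.eval z ≠ 0 := fun z hz => by
    rw [hdet, (hP z hz.le).2]
    exact hne _ _ _ (hP z hz.le).1 (hVinv z hz)
  have hSdet : ∀ z : ℂ, ‖z‖ = 1 → S.det.eval z ≠ 0 := fun z hz => by
    rw [hdet, (hS z hz.le).2]
    exact hne _ _ _ (hS z hz.le).1 (hWinv z hz)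
  have hPS : IsFactorable (fun z => (P * S.adjugate).map (eval z)) := by
    refine isFactorable_polynomial _ fun z hz => ?_
    rw [Matrix.det_mul, Matrix.det_adjugate, eval_mul, eval_pow]
    exact mul_ne_zero (hPdet z hz) (pow_ne_zero _ (hSdet z hz))
  have hq : IsFactorable (fun z => ((ρ.eval z)⁻¹ * σ.eval z) • ((S.det.eval z)⁻¹ •
      (P * S.adjugate).map (eval z))) := by
    refine (hPS.eval_inv_smul hSdet).plus_smul (p := fun z => (ρ.eval z)⁻¹ * σ.eval z)
      (fun z hz => ?_) fun z hz => ?_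
    · have hz1 : ‖z‖ ≤ 1 := by simpa using hz
      exact ((analyticOnNhd_eval ρ _ z hz).inv (hP z hz1).1).mul (analyticOnNhd_eval σ _ z hz)
    · have hz1 : ‖z‖ ≤ 1 := by simpa using hz
      exact mul_ne_zero (inv_ne_zero (hP z hz1).1) (hS z hz1).1
  refine IsFactorable.exists_hasWienerHopfIndices b (hq.congr fun z hz => ?_)
  change m (R z) = _
  have h1 : R z = v.transferFunction z * w.dual.transferFunction (1 / z) := by
    rw [hR z hz, Realization.paraAdjoint_transferFunction]
    rfl
  have h2 := (hS z hz.le).2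
  change S.map (evalRingHom z) = _ • m _ at h2
  have h3 : S.adjugate.map (evalRingHom z) =
      (S.det.eval z * (σ.eval z)⁻¹) • m (w.dual.transferFunction (1 / z)) := by
    have h4 : S.map (evalRingHom z) *
        ((σ.eval z)⁻¹ • m (w.dual.transferFunction (1 / z))) = 1 := by
      rw [h2, Matrix.smul_mul, Matrix.mul_smul, hWinv z hz, smul_smul,
        mul_inv_cancel₀ (hS z hz.le).1, one_smul]
    have h5 := congrArg (fun N => (S.map (evalRingHom z)).adjugate * N) h4
    simp only [← Matrix.mul_assoc, Matrix.adjugate_mul, Matrix.mul_one, Matrix.smul_mul,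
      Matrix.one_mul] at h5
    rw [smul_smul] at h5
    have h6 : S.adjugate.map (evalRingHom z) = (S.map (evalRingHom z)).adjugate :=
      RingHom.map_adjugate (evalRingHom z) S
    rw [h6, ← h5, hdet]
    rfl
  have h4 : (P * S.adjugate).map (eval z) =
      P.map (evalRingHom z) * S.adjugate.map (evalRingHom z) := Matrix.map_mul (f := evalRingHom z)
  have h5 : P.map (evalRingHom z) = ρ.eval z • m (v.transferFunction z) := (hP z hz.le).2
  rw [h1, hmul, h4, h3, h5, Matrix.smul_mul, Matrix.mul_smul, smul_smul, smul_smul, smul_smul]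
  have h6 := (hP z hz.le).1
  have h7 := (hS z hz.le).1
  have h8 := hSdet z hz
  have h9 : (ρ.eval z)⁻¹ * σ.eval z * ((S.det.eval z)⁻¹ * (ρ.eval z *
      (S.det.eval z * (σ.eval z)⁻¹))) = 1 := by field_simp
  rw [← mul_assoc] at h9
  simp only [← mul_assoc] at h9 ⊢
  rw [h9, one_smul]

end Existence

end WienerHopf

end

/-! ### The main theorem. -/

theorem corollary5p3
    {E Xv Xw : Type*}
    [NormedAddCommGroup E] [InnerProductSpace ℂ E] [FiniteDimensional ℂ E] [CompleteSpace E]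
    [NormedAddCommGroup Xv] [InnerProductSpace ℂ Xv] [FiniteDimensional ℂ Xv] [CompleteSpace Xv]
    [NormedAddCommGroup Xw] [InnerProductSpace ℂ Xw] [FiniteDimensional ℂ Xw] [CompleteSpace Xw]
    (v : WienerHopf.Realization Xv E) (w : WienerHopf.Realization Xw E)
    (hv_stable : v.IsStable) (hv_unitary : v.IsUnitary)
    (hw_stable : w.IsStable) (hw_unitary : w.IsUnitary)
    (R : ℂ → E →L[ℂ] E)
    (hR : ∀ z : ℂ, ‖z‖ = 1 →
      R z = v.transferFunction z ∘L WienerHopf.paraAdjoint w.transferFunction z) :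
    -- the Wiener-Hopf indices of `R` exist
    (∃ κ, WienerHopf.HasWienerHopfIndices R κ) ∧
    -- the Stein equation for `Ω_*` has a unique solution
    (∃! Ω : Xv →L[ℂ] Xw,
      Ω = w.A ∘L Ω ∘L ContinuousLinearMap.adjoint v.A
        + w.B ∘L ContinuousLinearMap.adjoint v.B) ∧
    ∀ (Ω : Xv →L[ℂ] Xw) (C : Xv →L[ℂ] E),
      Ω = w.A ∘L Ω ∘L ContinuousLinearMap.adjoint v.A
        + w.B ∘L ContinuousLinearMap.adjoint v.B →
      C = w.D ∘L ContinuousLinearMap.adjoint v.B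
        + w.C ∘L Ω ∘L ContinuousLinearMap.adjoint v.A →
      -- the Stein equation for `Q_*` has a unique solution
      (∃! Q : Xv →L[ℂ] Xv,
        Q = v.A ∘L Q ∘L ContinuousLinearMap.adjoint v.A
          + ContinuousLinearMap.adjoint C ∘L C) ∧
      ∀ Q : Xv →L[ℂ] Xv,
        Q = v.A ∘L Q ∘L ContinuousLinearMap.adjoint v.A
          + ContinuousLinearMap.adjoint C ∘L C →
        -- `ω_1 ≥ ... ≥ ω_q` are the positive Wiener-Hopf indices of `R`
        ∀ (κ : Fin (Module.finrank ℂ E) → ℤ) (q : ℕ) (ω : Fin q → ℤ),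
          WienerHopf.HasWienerHopfIndices R κ → WienerHopf.ListsPositive κ ω →
          (q : ℤ) = WienerHopf.nu v.A Q 1 ∧
          ∀ j : Fin q,
            {k : ℕ | 1 ≤ k ∧ ((j : ℕ) + 1 : ℤ) ≤ WienerHopf.nu v.A Q k}.Finite ∧
            ω j = ({k : ℕ | 1 ≤ k ∧ ((j : ℕ) + 1 : ℤ) ≤ WienerHopf.nu v.A Q k}.ncard : ℤ) := by
  refine ⟨WienerHopf.exists_hasWienerHopfIndices hv_stable hv_unitary hw_stable hw_unitary hR,
    hw_stable.isStableOperator.existsUnique_stein hv_stable.isStableOperator _,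
    fun Ω C hΩ hC => ⟨hv_stable.isStableOperator.existsUnique_stein hv_stable.isStableOperator _,
    fun Q hQ κ q ω hκ hω => ?_⟩⟩
  have hnu : ∀ k : ℕ, 1 ≤ k → WienerHopf.nu v.A Q k =
      ((Finset.univ.filter fun j => (k : ℤ) ≤ ω j).card : ℤ) := fun k hk => by
    rw [WienerHopf.nu_eq (WienerHopf.defectDim_eq hv_stable hv_unitary hw_stable hw_unitary hΩ hC
      hQ hR hκ) hk, WienerHopf.card_filter_of_listsPositive hω hk]
  have hpos := WienerHopf.pos_of_listsPositive hω
  refine ⟨?_, fun j => ?_⟩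
  · rw [hnu 1 le_rfl, Finset.filter_true_of_mem fun j _ => by have := hpos j; omega]
    simp
  -- For a decreasing list, $\nu_k\ge j+1$ with $j$ counted from $0$ means $k\le\omega_j$, so the
  -- set is the interval from $1$ to $\omega_j$.
  · have hset : {k : ℕ | 1 ≤ k ∧ ((j : ℕ) + 1 : ℤ) ≤ WienerHopf.nu v.A Q k} =
        Finset.Icc 1 (ω j).toNat := by
      ext k
      simp only [Set.mem_ofPred_eq, Finset.coe_Icc, Set.mem_Icc]
      refine and_congr_right fun hk => ?_
      rw [hnu k hk, ← Nat.cast_succ, Nat.cast_le,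
        WienerHopf.succ_le_card_filter_iff hω.1]
      have := hpos j
      omega
    rw [hset, Set.ncard_coe_finset]
    refine ⟨Finset.finite_toSet _, ?_⟩
    have := hpos j
    simp
    omega
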